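/- All manifolds are smooth, finite-dimensional, Hausdorff and second countable, without boundary. Let $G$ be a Lie group with Lie algebra $\mathfrak g$, and let $s\in S^2\mathfrak g$ be symmetric and $\mathrm{Ad}$-invariant. Define $s^\sharp:\mathfrak g^*\to\mathfrak g$ by $\beta(s^\sharp\alpha)=s(\alpha,\beta)$ and $\phi\in\bigwedge^3\mathfrak g$ by $\phi(\alpha,\beta,\gamma)=\tfrac14\,\alpha([s^\sharp\beta,s^\sharp\gamma])$. Let $(M,\rho,\pi)$ be a quasi-Poisson $G$-manifold, i.e. $\rho$ is a smooth action of $G$ on $M$, with infinitesimal action $\rho(\xi)_x=\frac{d}{dt}\big|_{0}\exp(-t\xi)\cdot x$, and $\pi$ is a $G$-invariant bivector field on $M$ with $\tfrac12[\pi,\pi]=\rho(\phi)$, where $\tfrac12[\pi,\pi](df_1,df_2,df_3)=\{f_1,\{f_2,f_3\}\}+\text{cyclic}$ and $\{f,g\}=\pi(df,dg)$. Let $\tau$ be an $s$-preserving automorphism of the Lie group $G$, and let $\mu:M\to G$ be a $\tau$-twisted moment map, i.e. $\mu$ is smooth, $\mu(g\cdot x)=\tau(g)\,\mu(x)\,g^{-1}$,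 and $$(\mu_*\otimes\mathrm{id})\,\pi=-\tfrac12\sum_{i,j}s^{ij}\,(e_i^L+\tau(e_i)^R)\otimes\rho(e_j),$$ where $(e_i)$ is a basis of $\mathfrak g$, $s=\sum s^{ij}e_i\otimes e_j$, and $\xi^L,\xi^R$ are the left and right invariant vector fields of $\xi\in\mathfrak g$. Let $C\subseteq G$ be a Lie subgroup with Lie algebra $\mathfrak c$ that is reducing, i.e. $\phi(\alpha,\beta,\gamma)=0$ for all $\alpha,\beta,\gamma\in\operatorname{ann}(\mathfrak c)$. Suppose that the $C$-orbits of $M$ form a regular foliation, i.e. the orbit space $M/C$ is a manifold and $q:M\to M/C$ is a surjective submersion. Let $\hat C\subseteq G\times G$ be a Lie subgroup that contains the diagonal $\{(c,c):c\in C\}$ and whose Lie algebra is $$\hat{\mathfrak c}=\{(\xi+s^\sharp\alpha,\ \xi-s^\sharp\alpha)\;:\;\xi\in\mathfrak c,\ \alpha\in\operatorname{ann}(\mathfrak c)\},$$ acting on $G$ by $(g_1,g_2)\cdot g=\tau(g_1)\,g\,g_2^{-1}$. Here "Lie subgroup" means an injectively immersed one. A "submanifold" is a weakly embedded (initial) submanifold: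 a subset with a second countable manifold structure for which the inclusion is an injective immersion through which smooth maps into the ambient manifold with values in the subset factor smoothly. This includes embedded submanifolds and $\hat C$-orbits. A Poisson submanifold of a Poisson manifold $(X,\pi_X)$ is a submanifold $S$ with $\pi_X|_x\in\bigwedge^2T_xS$ for all $x\in S$. Then $\pi$ descends to a unique bivector field on $M/C$, and this is a Poisson structure. Let $K\subseteq G$ be a $\hat C$-orbit or, more generally, any $\hat C$-stable submanifold of $G$. If the graph $\operatorname{gr}(\mu)=\{(\mu(x),x):x\in M\}\subseteq G\times M$ intersects $K$ cleanly, i.e. $\operatorname{gr}(\mu)\cap(K\times M)$ is a submanifold of $G\times M$ and $T(\operatorname{gr}(\mu)\cap(K\times M))=T\operatorname{gr}(\mu)\cap T(K\times M)$, then $$\mu^{-1}(K)/C=q(\mu^{-1}(K))\subseteq M/C$$ is a Poisson submanifold. If in addition $\operatorname{gr}(\mu)\cap(K\times M)$ is an embedded submanifold of $G\times M$, then $\mu^{-1}(K)/C$ is an embedded submanifold of $M/C$. -/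

import Mathlib

open scoped Manifold ContDiff

noncomputable section

namespace QuasiPoisson

/-! ### Submanifolds, described as subsets -/

section Submanifolds

variable {E : Type*} [NormedAddCommGroup E] [NormedSpace ℝ E]
  {H : Type*} [TopologicalSpace H] (I : ModelWithCorners ℝ E H)
  {X : Type*} [TopologicalSpace X] [ChartedSpace H X]

/-- A smooth curve in the manifold `X` all of whose points lie in `A`. -/
def IsSmoothCurveIn (A : Set X) (γ : ℝ → X) : Prop :=
  ContMDiff 𝓘(ℝ, ℝ) I ∞ γ ∧ ∀ t, γ t ∈ A

/-- The points of `A` that can be joined to `x` by a smooth curve of `X` lying in `A`. -/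
def smoothComponent (A : Set X) (x : X) : Set X :=
  {y | ∃ γ : ℝ → X, IsSmoothCurveIn I A γ ∧ γ 0 = x ∧ γ 1 = y}

/-- The tangent space at `x` of a subset `A` of `X`: the velocities at `x` of the smooth curves of
`X` that lie in `A`. For a (weakly embedded) submanifold this is its usual tangent space, seen
inside `T_x X`. -/
def tangentTo (A : Set X) (x : X) : Set (TangentSpace I x) :=
  {v | ∃ γ : ℝ → X, IsSmoothCurveIn I A γ ∧
    tangentMap 𝓘(ℝ, ℝ) I γ ⟨0, (1 : ℝ)⟩ = (⟨x, v⟩ : TangentBundle I X)}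

/-- (Weakly embedded, or "initial") submanifolds. Around each point `x` of `S` there is
a chart of `X` that maps the smooth component of `x` in `S` (within the chart domain) onto
a linear slice, and `S` has at most countably many smooth components. These are exactly the subsets
`S` with a second countable manifold structure for which the inclusion is an injective immersion
such that a map into `S` is smooth as soon as it is smooth as a map into `X`. All embedded
submanifolds and all orbits of Lie group actions are of this kind. -/
def IsSubmanifold (S : Set X) : Prop :=
  (∀ x ∈ S, ∃ φ ∈ IsManifold.maximalAtlas I ∞ X, x ∈ φ.source ∧ ∃ W : Submodule ℝ E,
    φ.extend I '' smoothComponent I (φ.source ∩ S) x = (φ.extend I).target ∩ W) ∧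
  ∃ D : Set X, D.Countable ∧ D ⊆ S ∧ ∀ x ∈ S, ∃ d ∈ D, x ∈ smoothComponent I S d

/-- Embedded submanifolds: around each point of `S` there is a chart of `X` that maps `S` onto
a linear slice. -/
def IsEmbeddedSubmanifold (S : Set X) : Prop :=
  ∀ x ∈ S, ∃ φ ∈ IsManifold.maximalAtlas I ∞ X, x ∈ φ.source ∧ ∃ W : Submodule ℝ E,
    φ.extend I '' (φ.source ∩ S) = (φ.extend I).target ∩ W

/-- `A` and `B` intersect cleanly: `A ∩ B` is a submanifold and `T(A ∩ B) = TA ∩ TB`. -/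
def IntersectCleanly (A B : Set X) : Prop :=
  IsSubmanifold I (A ∩ B) ∧
    ∀ x ∈ A ∩ B, tangentTo I (A ∩ B) x = tangentTo I A x ∩ tangentTo I B x

end Submanifolds

/-! ### Bivector fields and Poisson manifolds -/

section Bivectors

variable {E : Type*} [NormedAddCommGroup E] [NormedSpace ℝ E]
  {H : Type*} [TopologicalSpace H] (I : ModelWithCorners ℝ E H)
  {X : Type*} [TopologicalSpace X] [ChartedSpace H X]

/-- The cotangent space at `x` (the manifolds below are finite-dimensional). -/
abbrev Cotangent (x : X) : Type _ := Module.Dual ℝ (TangentSpace I x)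

/-- The differential of a real function at `x`, as a covector. -/
def diff (f : X → ℝ) (x : X) : Cotangent I x :=
  (mfderiv I 𝓘(ℝ, ℝ) f x : TangentSpace I x →L[ℝ] ℝ).toLinearMap

variable (X) in
/-- A smooth bivector field: an alternating bilinear form `(α, β) ↦ π_x(α, β)` on each cotangent
space, such that `π(df, dg)` is smooth for all smooth `f, g` (on the Hausdorff finite-dimensional
manifolds considered here this is smoothness as a section of the bundle). -/
@[ext]
structure BivectorField where
  /-- the value of the bivector at a point, on two covectors -/
  toFun : ∀ x : X, Cotangent I x →ₗ[ℝ] Cotangent I x →ₗ[ℝ] ℝ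
  alternating : ∀ x α, toFun x α α = 0
  smooth : ∀ f g : X → ℝ, ContMDiff I 𝓘(ℝ, ℝ) ∞ f → ContMDiff I 𝓘(ℝ, ℝ) ∞ g →
    ContMDiff I 𝓘(ℝ, ℝ) ∞ fun x => toFun x (diff I f x) (diff I g x)

variable {I}

/-- The bracket `{f, g} = π(df, dg)`. -/
def BivectorField.bracket (π : BivectorField I X) (f g : X → ℝ) : X → ℝ :=
  fun x => π.toFun x (diff I f x) (diff I g x)

/-- The value `½[π, π](df₁, df₂, df₃) = {f₁, {f₂, f₃}} + cyclic permutations` of (half) the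
Schouten bracket of `π` with itself. -/
def BivectorField.halfSchouten (π : BivectorField I X) (f₁ f₂ f₃ : X → ℝ) : X → ℝ :=
  fun x => π.bracket f₁ (π.bracket f₂ f₃) x + π.bracket f₂ (π.bracket f₃ f₁) x
    + π.bracket f₃ (π.bracket f₁ f₂) x

/-- `π` is a Poisson structure: `[π, π] = 0`. -/
def BivectorField.IsPoisson (π : BivectorField I X) : Prop :=
  ∀ f₁ f₂ f₃ : X → ℝ, ContMDiff I 𝓘(ℝ, ℝ) ∞ f₁ → ContMDiff I 𝓘(ℝ, ℝ) ∞ f₂ →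
    ContMDiff I 𝓘(ℝ, ℝ) ∞ f₃ → ∀ x, π.halfSchouten f₁ f₂ f₃ x = 0

/-- `S` is a Poisson submanifold of `(X, π)`: a submanifold with `π_x ∈ Λ² T_x S` for all `x ∈ S`,
i.e. all the vectors `π_x(·, α)` are tangent to `S`. -/
def BivectorField.IsPoissonSubmanifold (π : BivectorField I X) (S : Set X) : Prop :=
  IsSubmanifold I S ∧
    ∀ x ∈ S, ∀ α : Cotangent I x, ∃ v ∈ tangentTo I S x, ∀ β : Cotangent I x, β v = π.toFun x β α

/-- `π` on `X` descends along `q : X → Y` to `π'` on `Y`: `q_* π = π'`. -/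
def BivectorField.DescendsTo {E' : Type*} [NormedAddCommGroup E'] [NormedSpace ℝ E']
    {H' : Type*} [TopologicalSpace H'] {J : ModelWithCorners ℝ E' H'}
    {Y : Type*} [TopologicalSpace Y] [ChartedSpace H' Y]
    (π : BivectorField I X) (q : X → Y) (π' : BivectorField J Y) : Prop :=
  ∀ (x : X) (α β : Cotangent J (q x)),
    π'.toFun (q x) α β =
      π.toFun x (α ∘ₗ (mfderiv I J q x).toLinearMap) (β ∘ₗ (mfderiv I J q x).toLinearMap)

end Bivectors

/-! ### Lie groups -/

section LieGroups

variable {E : Type*} [NormedAddCommGroup E] [NormedSpace ℝ E]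
  {H : Type*} [TopologicalSpace H] (I : ModelWithCorners ℝ E H)
  {G : Type*} [TopologicalSpace G] [ChartedSpace H G] [Group G]
  {E' : Type*} [NormedAddCommGroup E'] [NormedSpace ℝ E']
  {H' : Type*} [TopologicalSpace H'] (J : ModelWithCorners ℝ E' H')
  {L : Type*} [TopologicalSpace L] [ChartedSpace H' L] [Group L]

/-- The map of Lie algebras (the differential at `1`) of a homomorphism of Lie groups. -/
def lieMap (f : G →* L) : GroupLieAlgebra I G →ₗ[ℝ] GroupLieAlgebra J L :=
  (show TangentSpace I (1 : G) →L[ℝ] TangentSpace J (1 : L) from mfderiv I J f (1 : G)).toLinearMap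

/-- `Ad_g`, the differential at `1` of `x ↦ g x g⁻¹`. -/
def adj (g : G) : GroupLieAlgebra I G →ₗ[ℝ] GroupLieAlgebra I G :=
  lieMap I I (MulAut.conj g).toMonoidHom

/-- `ξ ↦ ξ^L_g`, the value at `g` of the left invariant vector field of `ξ`. -/
def leftField (g : G) : GroupLieAlgebra I G →ₗ[ℝ] TangentSpace I g :=
  (show TangentSpace I (1 : G) →L[ℝ] TangentSpace I g from
    mfderiv I I (fun x : G => g * x) (1 : G)).toLinearMap

/-- `ξ ↦ ξ^R_g`, the value at `g` of the right invariant vector field of `ξ`. -/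
def rightField (g : G) : GroupLieAlgebra I G →ₗ[ℝ] TangentSpace I g :=
  (show TangentSpace I (1 : G) →L[ℝ] TangentSpace I g from
    mfderiv I I (fun x : G => x * g) (1 : G)).toLinearMap

/-- `L`, with the homomorphism `ι : L → G`, is an (immersed) Lie subgroup of `G`. An injective
smooth homomorphism of Lie groups is automatically an immersion. -/
structure IsLieSubgroup (ι : L →* G) : Prop where
  injective : Function.Injective ι
  smooth : ContMDiff J I ∞ ι

/-- Symmetric bilinear forms on `𝔤*`, i.e. elements `s ∈ S² 𝔤`. -/
abbrev Tensor2 (G : Type*) [TopologicalSpace G] [ChartedSpace H G] [Group G] : Type _ :=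
  Module.Dual ℝ (GroupLieAlgebra I G) →ₗ[ℝ] Module.Dual ℝ (GroupLieAlgebra I G) →ₗ[ℝ] ℝ

variable {I}

/-- `s` is symmetric and `Ad`-invariant. -/
structure IsInvariantSymmetric (s : Tensor2 I G) : Prop where
  symm : ∀ α β, s α β = s β α
  ad_invariant : ∀ (g : G) α β, s (α ∘ₗ adj I g) (β ∘ₗ adj I g) = s α β

variable [FiniteDimensional ℝ E]

instance instFiniteDimensionalTangentSpace {X : Type*} [TopologicalSpace X] [ChartedSpace H X]
    (x : X) : FiniteDimensional ℝ (TangentSpace I x) :=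
  inferInstanceAs (FiniteDimensional ℝ E)

/-- `s^♯ : 𝔤* → 𝔤`, defined by `β (s^♯ α) = s(α, β)`. -/
def sharp (s : Tensor2 I G) : Module.Dual ℝ (GroupLieAlgebra I G) →ₗ[ℝ] GroupLieAlgebra I G :=
  (Module.evalEquiv ℝ (GroupLieAlgebra I G)).symm.toLinearMap ∘ₗ s

theorem apply_sharp (s : Tensor2 I G) (α β : Module.Dual ℝ (GroupLieAlgebra I G)) :
    β (sharp s α) = s α β := by
  simp [sharp]

/-- `φ(α, β, γ) = ¼ α([s^♯ β, s^♯ γ])`. -/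
def cartan (s : Tensor2 I G) (α β γ : Module.Dual ℝ (GroupLieAlgebra I G)) : ℝ :=
  1 / 4 * α ⁅sharp s β, sharp s γ⁆

/-- The Lie subgroup with Lie algebra `c ⊆ 𝔤` is reducing: `φ` vanishes on `ann(c)`. -/
def IsReducing (s : Tensor2 I G) (c : Submodule ℝ (GroupLieAlgebra I G)) : Prop :=
  ∀ α ∈ c.dualAnnihilator, ∀ β ∈ c.dualAnnihilator, ∀ γ ∈ c.dualAnnihilator, cartan s α β γ = 0

/-- `ĉ = {(ξ + s^♯ α, ξ - s^♯ α) : ξ ∈ c, α ∈ ann(c)} ⊆ 𝔤 ⊕ 𝔤`. -/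
def hatAlgebra (s : Tensor2 I G) (c : Submodule ℝ (GroupLieAlgebra I G)) :
    Set (GroupLieAlgebra I G × GroupLieAlgebra I G) :=
  {p | ∃ ξ ∈ c, ∃ α ∈ c.dualAnnihilator, p = (ξ + sharp s α, ξ - sharp s α)}

/-- The Lie algebra of a Lie group `L` with a homomorphism to `G × G`, as a subset of `𝔤 ⊕ 𝔤`. -/
def lieAlgebraInProd (ι : L →* G × G) : Set (GroupLieAlgebra I G × GroupLieAlgebra I G) :=
  Set.range fun ζ : GroupLieAlgebra J L =>
    (lieMap J I ((MonoidHom.fst G G).comp ι) ζ, lieMap J I ((MonoidHom.snd G G).comp ι) ζ)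

/-- `τ` is an `s`-preserving automorphism of the Lie group `G`. -/
structure IsPreservingAut (s : Tensor2 I G) (τ : G ≃* G) : Prop where
  smooth : ContMDiff I I ∞ τ
  smooth_symm : ContMDiff I I ∞ τ.symm
  preserves : ∀ α β,
    s (α ∘ₗ lieMap I I τ.toMonoidHom) (β ∘ₗ lieMap I I τ.toMonoidHom) = s α β

end LieGroups

/-! ### Quasi-Poisson manifolds, moment maps, quotients -/

section Main

variable {E : Type*} [NormedAddCommGroup E] [NormedSpace ℝ E]
  {H : Type*} [TopologicalSpace H] {I : ModelWithCorners ℝ E H}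
  {G : Type*} [TopologicalSpace G] [ChartedSpace H G] [Group G]
  {E' : Type*} [NormedAddCommGroup E'] [NormedSpace ℝ E']
  {H' : Type*} [TopologicalSpace H'] {J : ModelWithCorners ℝ E' H'}
  {M : Type*} [TopologicalSpace M] [ChartedSpace H' M] [MulAction G M]

variable (I J) in
/-- The infinitesimal action `ξ ↦ ρ(ξ)_x = d/dt|₀ exp(-tξ) • x`. The sign makes `ρ` a homomorphism
from `𝔤` (with the bracket of left invariant vector fields) to vector fields on `M`. -/
def infAction (x : M) : GroupLieAlgebra I G →ₗ[ℝ] TangentSpace J x :=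
  -(show TangentSpace I (1 : G) →L[ℝ] TangentSpace J x from
    mfderiv I J (fun g : G => g • x) (1 : G)).toLinearMap

/-- `(M, ρ, π)` is a quasi-Poisson `G`-manifold (with respect to `s`): `π` is `G`-invariant and
`½[π, π] = ρ(φ)`. The smoothness of the action is assumed separately. -/
structure IsQuasiPoisson [FiniteDimensional ℝ E] (s : Tensor2 I G) (π : BivectorField J M) :
    Prop where
  invariant : ∀ g : G, π.DescendsTo (fun x => g • x) π
  schouten : ∀ f₁ f₂ f₃ : M → ℝ, ContMDiff J 𝓘(ℝ, ℝ) ∞ f₁ → ContMDiff J 𝓘(ℝ, ℝ) ∞ f₂ →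
    ContMDiff J 𝓘(ℝ, ℝ) ∞ f₃ → ∀ x, π.halfSchouten f₁ f₂ f₃ x =
      cartan s (diff J f₁ x ∘ₗ infAction I J x) (diff J f₂ x ∘ₗ infAction I J x)
        (diff J f₃ x ∘ₗ infAction I J x)

/-- `μ : M → G` is a `τ`-twisted moment map: it is equivariant for `g · h = τ(g) h g⁻¹`, and
`(μ_* ⊗ id) π = -½ ∑ s^{ij} (e_i^L + τ(e_i)^R) ⊗ ρ(e_j)`, the latter being evaluated on a covector
`α` of `G` at `μ x` and a covector `β` of `M` at `x`. -/
structure IsMomentMap (s : Tensor2 I G) (τ : G ≃* G) (π : BivectorField J M) (μ : M → G) :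
    Prop where
  smooth : ContMDiff J I ∞ μ
  equivariant : ∀ (g : G) (x : M), μ (g • x) = τ g * μ x * g⁻¹
  moment : ∀ (x : M) (α : Cotangent I (μ x)) (β : Cotangent J x),
    π.toFun x (α ∘ₗ (mfderiv J I μ x).toLinearMap) β =
      -(1 / 2) * s
        (α ∘ₗ (leftField I (μ x) + rightField I (μ x) ∘ₗ lieMap I I τ.toMonoidHom))
        (β ∘ₗ infAction I J x)

/-- `q : M → Q` exhibits the manifold `Q` as the orbit space `M/C` of a subgroup `ι : C → G`,
with `M → M/C` a surjective submersion, i.e. the `C`-orbits form a regular foliation. -/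
structure IsOrbitSpace {C : Type*} [Group C] (ι : C →* G)
    {E'' : Type*} [NormedAddCommGroup E''] [NormedSpace ℝ E'']
    {H'' : Type*} [TopologicalSpace H''] (J : ModelWithCorners ℝ E' H')
    (K : ModelWithCorners ℝ E'' H'')
    {Q : Type*} [TopologicalSpace Q] [ChartedSpace H'' Q] (q : M → Q) : Prop where
  surjective : Function.Surjective q
  submersion : Manifold.IsSubmersion J K ∞ q
  fibers : ∀ x y, q x = q y ↔ ∃ c : C, ι c • x = y

/-- The action `(g₁, g₂) · h = τ(g₁) h g₂⁻¹` of `G × G` on `G`. -/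
def twistedAct (τ : G ≃* G) (p : G × G) (h : G) : G := τ p.1 * h * p.2⁻¹

/-- The graph `{(μ x, x) : x ∈ M} ⊆ G × M`. -/
def graph (μ : M → G) : Set (G × M) := Set.range fun x => (μ x, x)

/-- The orbit of `g₀ ∈ G` under a subgroup `ι : L → G × G`, acting by `twistedAct`. -/
def hatOrbit {L : Type*} [Group L] (ι : L →* G × G) (τ : G ≃* G) (g₀ : G) : Set G :=
  Set.range fun l : L => twistedAct τ (ι l) g₀

/-- `K ⊆ G` is stable under a subgroup `ι : L → G × G`, acting by `twistedAct`. -/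
def IsHatStable {L : Type*} [Group L] (ι : L →* G × G) (τ : G ≃* G) (K : Set G) : Prop :=
  ∀ l : L, ∀ k ∈ K, twistedAct τ (ι l) k ∈ K

end Main

end QuasiPoisson

end

noncomputable section

namespace QuasiPoisson

open Set Filter Topology

/-! ### Images of smooth retractions are submanifolds -/

section Retraction

variable {F : Type*} [NormedAddCommGroup F] [NormedSpace ℝ F] [CompleteSpace F]

/-! Since `π` is `G`-invariant, its push-forward along `q` is constant on `C`-orbits and so descends
to `M/C` (`IsOrbitSpace.pushForwardAt_eq`, `exists_descendsTo`). Covectors pulled back along `q`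
kill the `C`-directions, so composing them with `ρ` gives elements of `ann(c)`. There `φ` vanishes
because `C` is reducing, and `½[π, π] = ρ(φ)` yields the Jacobi identity downstairs
(`IsOrbitSpace.isPoisson`).

As `Ĉ` contains the diagonal of `C`, the set `μ⁻¹(K)` is a union of `C`-orbits. Hence any local
section `σ` of `q` lifts `T = q(μ⁻¹(K))` into `S = gr(μ) ∩ (K × M)` by `y ↦ (μ(σ y), σ y)`. Lifting
to `S`, projecting linearly onto a slice of `S` in an adapted chart and mapping back to `M/C` is a
smooth local retraction onto `T`. The fixed points of a smooth idempotent form a slice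
(`exists_chart_fixedPoints`), so `T` inherits from `S` the property of being initial or embedded
(`IsSubmanifold.of_sections`, `IsEmbeddedSubmanifold.of_sections`).

For tangency, let `A = q^*α`, `v = π(·, A)` and `a = -½ A ∘ ρ ∈ ann(c)`. The moment condition gives
`μ_* v = τ(s^♯ a)^R + (s^♯ a)^L` (`IsMomentMap.mfderiv_eq`). This is the generator at `μ x` of `(s^♯
a, -s^♯ a) ∈ ĉ`, so it is tangent to the `Ĉ`-stable set `K`. Cleanness makes `(μ_* v, v)` tangent to
`S` (`IsMomentMap.mem_tangentTo`), and so `q_* v`, which is the Hamiltonian vector of `α` on `M/C`,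
is tangent to `T`. -/

theorem eventually_contDiffAt_symm (h : OpenPartialHomeomorph F F) {U : Set F}
    (hU : IsOpen U) (hs : ContDiffOn ℝ ∞ h U) {x : F} (hx : x ∈ h.source) (hxU : x ∈ U)
    (hd : IsUnit (fderiv ℝ h x)) : ∀ᶠ y in 𝓝 x, ContDiffAt ℝ ∞ h.symm (h y) := by
  have hc : ContinuousAt (fderiv ℝ h) x :=
    (hs.continuousOn_fderiv_of_isOpen hU (by simp)).continuousAt (hU.mem_nhds hxU)
  -- The inverse function theorem gives smoothness of the inverse at one point; invertibility of the
  -- derivative is an open condition, so the theorem applies at all nearby points.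
  filter_upwards [hc.preimage_mem_nhds (Units.isOpen.mem_nhds hd), hU.mem_nhds hxU,
    h.open_source.mem_nhds hx] with y hy hyU hyS
  obtain ⟨u, hu⟩ := hy
  have hsy : ContDiffAt ℝ ∞ h y := hs.contDiffAt (hU.mem_nhds hyU)
  refine h.contDiffAt_symm (f₀' := ContinuousLinearEquiv.ofUnit u) (h.map_source hyS) ?_ ?_
  · rw [h.left_inv hyS]
    have := (hsy.differentiableAt (by simp)).hasFDerivAt
    rw [← hu] at this
    exact this
  · rwa [h.left_inv hyS]

/-- Near a fixed point, an idempotent smooth map is conjugate to a linear projection; in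
particular its set of fixed points is a linear slice in a suitable chart. -/
theorem exists_chart_fixedPoints {r : F → F} {U : Set F} (hU : IsOpen U) {x : F} (hxU : x ∈ U)
    (hr : ContDiffOn ℝ ∞ r U) (hrx : r x = x) (hi : ∀ y ∈ U, r (r y) = r y) :
    ∃ h : OpenPartialHomeomorph F F, x ∈ h.source ∧ h.source ⊆ U ∧ h x = 0 ∧
      ContDiffOn ℝ ∞ h h.source ∧ ContDiffOn ℝ ∞ h.symm h.target ∧
      (∃ ε > 0, h.target = Metric.ball 0 ε) ∧
      ∃ W : Submodule ℝ F, ∀ y ∈ h.source, r y = y ↔ h y ∈ W := by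
  have hrd : ContDiffAt ℝ ∞ r x := hr.contDiffAt (hU.mem_nhds hxU)
  have hr' : HasFDerivAt r (fderiv ℝ r x) x := (hrd.differentiableAt (by simp)).hasFDerivAt
  set A := fderiv ℝ r x with hA
  have hAA : A ∘L A = A := by
    have h1 : HasFDerivAt (r ∘ r) (A ∘L A) x := by
      refine HasFDerivAt.comp x ?_ hr'
      rwa [hrx]
    have h2 : HasFDerivAt (r ∘ r) A x :=
      hr'.congr_of_eventuallyEq (by filter_upwards [hU.mem_nhds hxU] with y hy using hi y hy)
    exact h1.unique h2
  have hAA' : ∀ v, A (A v) = A v := fun v => congrArg (fun B : F →L[ℝ] F => B v) hAA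
  -- Chosen so that `k ∘ r = A ∘ k` near `x`, while the derivative at `x` is `A² + (1 - A)² = 1`.
  let k : F → F := fun y => A (r y - x) + ((y - r y) - A (y - r y))
  have hk : ContDiffOn ℝ ∞ k U := by
    have h1 : ContDiffOn ℝ ∞ (fun y => y - r y) U := contDiffOn_id.sub hr
    exact (A.contDiff.comp_contDiffOn (hr.sub contDiffOn_const)).add
      (h1.sub (A.contDiff.comp_contDiffOn h1))
  have hkx : k x = 0 := by simp [k, hrx]
  have hk' : HasFDerivAt k (ContinuousLinearEquiv.refl ℝ F : F →L[ℝ] F) x := by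
    have h1 : HasFDerivAt (fun y => y - r y) (ContinuousLinearMap.id ℝ F - A) x :=
      (hasFDerivAt_id x).sub hr'
    have := (A.hasFDerivAt.comp x (hr'.sub_const x)).add (h1.sub (A.hasFDerivAt.comp x h1))
    refine this.congr_fderiv ?_
    ext v
    simp [hAA']
  have hkd : ContDiffAt ℝ ∞ k x := hk.contDiffAt (hU.mem_nhds hxU)
  let h₀ := hkd.toOpenPartialHomeomorph k hk' (by simp)
  have hx₀ : x ∈ h₀.source := hkd.mem_toOpenPartialHomeomorph_source hk' (by simp)
  have h₀k : ∀ y, h₀ y = k y := fun y => rfl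
  have hev : ∀ᶠ y in 𝓝 x, y ∈ U ∧ y ∈ h₀.source ∧ r y ∈ h₀.source ∧
      ContDiffAt ℝ ∞ h₀.symm (h₀ y) := by
    have h1 : IsUnit (fderiv ℝ h₀ x) := by
      have : fderiv ℝ h₀ x = 1 := hk'.fderiv
      rw [this]
      exact isUnit_one
    have h2 : r ⁻¹' h₀.source ∈ 𝓝 x := by
      refine hrd.continuousAt.preimage_mem_nhds ?_
      rw [hrx]
      exact h₀.open_source.mem_nhds hx₀
    filter_upwards [hU.mem_nhds hxU, h₀.open_source.mem_nhds hx₀, h2,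
      eventually_contDiffAt_symm h₀ hU hk hx₀ hxU h1] with y h3 h4 h5 h6
    exact ⟨h3, h4, h5, h6⟩
  obtain ⟨O, hO, hOo, hxO⟩ := eventually_nhds_iff.1 hev
  have hT : IsOpen (h₀.target ∩ h₀.symm ⁻¹' O) := h₀.symm.isOpen_inter_preimage hOo
  have h0T : (0 : F) ∈ h₀.target ∩ h₀.symm ⁻¹' O := by
    rw [← hkx, ← h₀k]
    exact ⟨h₀.map_source hx₀, by rw [mem_preimage, h₀.left_inv hx₀]; exact hxO⟩
  obtain ⟨ε, hε, hball⟩ := Metric.isOpen_iff.1 hT 0 h0T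
  let h := (h₀.symm.restrOpen (Metric.ball 0 ε) Metric.isOpen_ball).symm
  have htarget : h.target = Metric.ball 0 ε := by
    change h₀.target ∩ Metric.ball 0 ε = _
    exact inter_eq_right.2 fun y hy => (hball hy).1
  have hsource : ∀ y ∈ h.source, y ∈ h₀.source ∧ y ∈ O := by
    intro y hy
    have h1 : h.symm (h y) = y := h.left_inv hy
    have h2 : h y ∈ Metric.ball 0 ε := htarget ▸ h.map_source hy
    have h3 : h₀.symm (h y) = y := h1
    exact ⟨h3 ▸ h₀.map_target (hball h2).1, h3 ▸ (hball h2).2⟩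
  have hhk : ∀ y, h y = k y := fun y => rfl
  have h0x : x ∈ h.source := by
    have h1 : (0 : F) ∈ h.target := htarget ▸ Metric.mem_ball_self hε
    have h2 : h.symm 0 = x := by
      rw [← hkx]
      exact h₀.left_inv hx₀
    exact h2 ▸ h.map_target h1
  refine ⟨h, h0x, fun y hy => (hO y (hsource y hy).2).1, hkx,
    hk.mono fun y hy => (hO y (hsource y hy).2).1, ?_, ⟨ε, hε, htarget⟩,
    LinearMap.range A.toLinearMap, ?_⟩
  · intro z hz
    rw [htarget] at hz
    have h1 := (hO _ (hball hz).2).2.2.2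
    rw [h₀.right_inv (hball hz).1] at h1
    exact h1.contDiffWithinAt
  · intro y hy
    obtain ⟨hyU, hyS, hryS, -⟩ := hO y (hsource y hy).2
    rw [hhk]
    constructor
    · intro e
      exact ⟨r y - x, by simp [k, e]⟩
    · rintro ⟨v, hv⟩
      have h1 : A (k y) = k y := by
        rw [← hv]; exact hAA' v
      have h2 : A (k y) = A (r y - x) := by
        simp only [k, map_add, map_sub, hAA']
        abel
      have h3 : k (r y) = A (r y - x) := by
        simp only [k, hi y hyU]
        simp
      -- If `k y` lies in the range of `A`, then `k (r y) = A (k y) = k y`, and injectivity of `k`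
      -- gives `r y = y`.
      exact h₀.injOn hryS hyS (by rw [h₀k, h₀k, h3, ← h2, h1])

end Retraction

/-! ### Smooth curves in subsets and smooth components -/

section SmoothComponents

variable {E : Type*} [NormedAddCommGroup E] [NormedSpace ℝ E]
  {H : Type*} [TopologicalSpace H] {I : ModelWithCorners ℝ E H}
  {X : Type*} [TopologicalSpace X] [ChartedSpace H X]
  {E' : Type*} [NormedAddCommGroup E'] [NormedSpace ℝ E']
  {H' : Type*} [TopologicalSpace H'] {J : ModelWithCorners ℝ E' H'}
  {Y : Type*} [TopologicalSpace Y] [ChartedSpace H' Y]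

theorem IsSmoothCurveIn.comp {A U : Set X} {B : Set Y} {γ : ℝ → X} (hγ : IsSmoothCurveIn I A γ)
    {f : X → Y} (hU : IsOpen U) (hf : ContMDiffOn I J ∞ f U) (hAU : A ⊆ U) (hAB : MapsTo f A B) :
    IsSmoothCurveIn J B (f ∘ γ) :=
  ⟨fun t => ((hf.contMDiffAt (hU.mem_nhds (hAU (hγ.2 t)))).comp t (hγ.1 t)), fun t => hAB (hγ.2 t)⟩

theorem map_mem_smoothComponent {A U : Set X} {B : Set Y} {x y : X} (hy : y ∈ smoothComponent I A x)
    {f : X → Y} (hU : IsOpen U) (hf : ContMDiffOn I J ∞ f U) (hAU : A ⊆ U) (hAB : MapsTo f A B) :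
    f y ∈ smoothComponent J B (f x) := by
  obtain ⟨γ, hγ, rfl, rfl⟩ := hy
  exact ⟨f ∘ γ, hγ.comp hU hf hAU hAB, rfl, rfl⟩

theorem mem_of_mem_smoothComponent {A : Set X} {x y : X} (hy : y ∈ smoothComponent I A x) :
    y ∈ A := by
  obtain ⟨γ, hγ, rfl, rfl⟩ := hy
  exact hγ.2 1

theorem mem_smoothComponent_self {A : Set X} {x : X} (hx : x ∈ A) : x ∈ smoothComponent I A x :=
  ⟨fun _ => x, ⟨contMDiff_const, fun _ => hx⟩, rfl, rfl⟩

theorem smoothComponent_mono {A B : Set X} (h : A ⊆ B) (x : X) :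
    smoothComponent I A x ⊆ smoothComponent I B x := by
  rintro y ⟨γ, hγ, h0, h1⟩
  exact ⟨γ, ⟨hγ.1, fun t => h (hγ.2 t)⟩, h0, h1⟩

/-- Star-shaped sets are smoothly connected. -/
theorem mem_smoothComponent_of_starConvex {A : Set E} {x y : E} (hA : StarConvex ℝ x A)
    (hy : y ∈ A) : y ∈ smoothComponent 𝓘(ℝ, E) A x := by
  -- Curves must stay in `A` for all real times, so the segment is reparametrized to be constant
  -- outside `[0, 1]`.
  refine ⟨fun t => x + Real.smoothTransition t • (y - x), ⟨?_, fun t => ?_⟩, by simp, by simp⟩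
  · rw [contMDiff_iff_contDiff]
    exact contDiff_const.add (Real.smoothTransition.contDiff.smul contDiff_const)
  · exact hA.add_smul_sub_mem hy (Real.smoothTransition.nonneg t) (Real.smoothTransition.le_one t)

end SmoothComponents

/-! ### Adapted charts from local retractions of a manifold -/

section RetractionManifold

variable {E : Type*} [NormedAddCommGroup E] [NormedSpace ℝ E]
  {Q : Type*} [TopologicalSpace Q] [ChartedSpace E Q] [IsManifold 𝓘(ℝ, E) ∞ Q]

theorem eventually_mem_smoothComponent {V : Set Q} (hV : IsOpen V) {y₀ : Q} (hy₀ : y₀ ∈ V) :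
    ∀ᶠ y in 𝓝 y₀, y ∈ smoothComponent 𝓘(ℝ, E) V y₀ := by
  set c := chartAt E y₀
  have hc : y₀ ∈ c.source := mem_chart_source E y₀
  have hT : IsOpen (c.target ∩ c.symm ⁻¹' V) := c.symm.isOpen_inter_preimage hV
  have h0T : c y₀ ∈ c.target ∩ c.symm ⁻¹' V :=
    ⟨c.map_source hc, by rwa [mem_preimage, c.left_inv hc]⟩
  obtain ⟨ε, hε, hball⟩ := Metric.isOpen_iff.1 hT _ h0T
  filter_upwards [c.open_source.mem_nhds hc,
    (c.continuousAt hc).preimage_mem_nhds (Metric.ball_mem_nhds _ hε)] with y hy hyb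
  have h1 : c y ∈ smoothComponent 𝓘(ℝ, E) (Metric.ball (c y₀) ε) (c y₀) :=
    mem_smoothComponent_of_starConvex
      ((convex_ball _ _).starConvex (Metric.mem_ball_self hε)) hyb
  have h2 := map_mem_smoothComponent h1 (f := c.symm) (J := 𝓘(ℝ, E)) (B := V) c.open_target
    (contMDiffOn_symm_of_mem_maximalAtlas (IsManifold.chart_mem_maximalAtlas y₀))
    (fun z hz => (hball hz).1) (fun z hz => (hball hz).2)
  rwa [c.left_inv hc, c.left_inv hy] at h2

/-- Around a point of its image, the fixed point set of a locally defined idempotent smooth map is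
a linear slice in a suitable chart whose image is a ball. -/
theorem exists_chart_fixedPoints_manifold [CompleteSpace E] {r : Q → Q} {V : Set Q} (hV : IsOpen V)
    {y₀ : Q} (hy₀ : y₀ ∈ V) (hr : ContMDiffOn 𝓘(ℝ, E) 𝓘(ℝ, E) ∞ r V) (hry : r y₀ = y₀)
    (hi : ∀ᶠ y in 𝓝 y₀, r (r y) = r y) :
    ∃ φ ∈ IsManifold.maximalAtlas 𝓘(ℝ, E) ∞ Q, y₀ ∈ φ.source ∧ φ.source ⊆ V ∧ φ y₀ = 0 ∧
      (∃ ε > 0, φ.target = Metric.ball 0 ε) ∧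
      ∃ W : Submodule ℝ E, ∀ y ∈ φ.source, r y = y ↔ φ y ∈ W := by
  set c := chartAt E y₀
  have hcm : c ∈ IsManifold.maximalAtlas 𝓘(ℝ, E) ∞ Q := IsManifold.chart_mem_maximalAtlas y₀
  have hcs := contMDiffOn_of_mem_maximalAtlas hcm
  have hcs' := contMDiffOn_symm_of_mem_maximalAtlas hcm
  have hc : y₀ ∈ c.source := mem_chart_source E y₀
  have hev : ∀ᶠ y in 𝓝 y₀, y ∈ c.source ∧ y ∈ V ∧ r y ∈ c.source ∧ r (r y) = r y := by
    have h1 : r ⁻¹' c.source ∈ 𝓝 y₀ := by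
      refine (hr.contMDiffAt (hV.mem_nhds hy₀)).continuousAt.preimage_mem_nhds ?_
      rw [hry]
      exact c.open_source.mem_nhds hc
    filter_upwards [c.open_source.mem_nhds hc, hV.mem_nhds hy₀, h1, hi] with y h2 h3 h4 h5
    exact ⟨h2, h3, h4, h5⟩
  obtain ⟨O, hO, hOo, hyO⟩ := eventually_nhds_iff.1 hev
  have hU : IsOpen (c.target ∩ c.symm ⁻¹' O) := c.symm.isOpen_inter_preimage hOo
  have hOV : ContMDiffOn 𝓘(ℝ, E) 𝓘(ℝ, E) ∞ r O := hr.mono fun y hy => (hO y hy).2.1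
  obtain ⟨h, hx, hsub, h0, hs, hs', ⟨ε, hε, hball⟩, W, hW⟩ :=
    exists_chart_fixedPoints (r := c ∘ r ∘ c.symm) hU (x := c y₀)
      ⟨c.map_source hc, by rwa [mem_preimage, c.left_inv hc]⟩
      (contMDiffOn_iff_contDiffOn.1 (hcs.comp (hOV.comp (hcs'.mono inter_subset_left)
        fun y hy => hy.2) fun y hy => (hO _ hy.2).2.2.1))
      (by simp [c.left_inv hc, hry])
      (fun y hy => by
        have := hO _ hy.2
        simp only [Function.comp_apply, c.left_inv this.2.2.1, this.2.2.2])
  have hsrc : (c.trans h).source = c.source ∩ c ⁻¹' h.source := c.trans_source h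
  have hO' : ∀ y ∈ (c.trans h).source, y ∈ O := by
    intro y hy
    rw [hsrc] at hy
    have := (hsub hy.2).2
    rwa [mem_preimage, c.left_inv hy.1] at this
  have htgt : (c.trans h).target = h.target := by
    rw [c.trans_target]
    exact inter_eq_left.2 fun z hz => (hsub (h.map_target hz)).1
  refine ⟨c.trans h, ?_, ?_, fun y hy => (hO y (hO' y hy)).2.1, h0, ⟨ε, hε, htgt.trans hball⟩,
    W, ?_⟩
  · refine OpenPartialHomeomorph.mem_maximalAtlas_of_contMDiffOn _ ?_ ?_
    · rw [hsrc]
      exact (contMDiffOn_iff_contDiffOn.2 hs).comp (hcs.mono inter_subset_left) fun y hy => hy.2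
    · rw [htgt]
      exact hcs'.comp (contMDiffOn_iff_contDiffOn.2 hs') fun z hz => (hsub (h.map_target hz)).1
  · rw [hsrc]
    exact ⟨hc, hx⟩
  · intro y hy
    have h1 := hO y (hO' y hy)
    rw [hsrc] at hy
    have h2 := hW (c y) hy.2
    simp only [Function.comp_apply, c.left_inv hy.1] at h2
    rw [OpenPartialHomeomorph.coe_trans, Function.comp_apply, ← h2]
    exact ⟨fun e => by rw [e], fun e => c.injOn h1.2.2.1 h1.1 e⟩

/-- Close to `y₀` the point `r y` is again in `V`, hence in `V ∩ T`, so `r` is idempotent there and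
`T` is its fixed point set. -/
theorem exists_slice_of_retraction [CompleteSpace E] {T : Set Q} {r : Q → Q} {V : Set Q}
    (hV : IsOpen V) {y₀ : Q} (hy₀ : y₀ ∈ V) (hr : ContMDiffOn 𝓘(ℝ, E) 𝓘(ℝ, E) ∞ r V)
    (hry : r y₀ = y₀) (hrT : ∀ y ∈ V, r y ∈ T) (hfix : ∀ y ∈ V ∩ T, r y = y) :
    ∃ φ ∈ IsManifold.maximalAtlas 𝓘(ℝ, E) ∞ Q, y₀ ∈ φ.source ∧ ∃ W : Submodule ℝ E,
      φ.extend 𝓘(ℝ, E) '' (φ.source ∩ T) = (φ.extend 𝓘(ℝ, E)).target ∩ W := by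
  have hi : ∀ᶠ y in 𝓝 y₀, r (r y) = r y := by
    have h1 : r ⁻¹' V ∈ 𝓝 y₀ := by
      refine (hr.contMDiffAt (hV.mem_nhds hy₀)).continuousAt.preimage_mem_nhds ?_
      rw [hry]
      exact hV.mem_nhds hy₀
    filter_upwards [hV.mem_nhds hy₀, h1] with y hy hy'
    exact hfix _ ⟨hy', hrT y hy⟩
  obtain ⟨φ, hφ, h0, hsub, -, -, W, hW⟩ := exists_chart_fixedPoints_manifold hV hy₀ hr hry hi
  refine ⟨φ, hφ, h0, W, ?_⟩
  simp only [mfld_simps]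
  ext z
  constructor
  · rintro ⟨y, ⟨hy, hyT⟩, rfl⟩
    exact ⟨φ.map_source hy, (hW y hy).1 (hfix y ⟨hsub hy, hyT⟩)⟩
  · rintro ⟨hz, hzW⟩
    have hy := φ.map_target hz
    refine ⟨φ.symm z, ⟨hy, ?_⟩, φ.right_inv hz⟩
    have h1 : r (φ.symm z) = φ.symm z := (hW _ hy).2 (by rwa [φ.right_inv hz])
    rw [← h1]
    exact hrT _ (hsub hy)

/-- Here `r` fixes only the smooth component of `y₀`, since other sheets of `T` may accumulate at
`y₀`. Smooth curves make up for this: they show that `r` is idempotent near `y₀` and that the slice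
lies in one component. -/
theorem exists_initial_slice_of_retraction [CompleteSpace E] {T : Set Q} {r : Q → Q} {V : Set Q}
    (hV : IsOpen V) {y₀ : Q} (hy₀ : y₀ ∈ V) (hr : ContMDiffOn 𝓘(ℝ, E) 𝓘(ℝ, E) ∞ r V)
    (hry : r y₀ = y₀) (hrT : ∀ y ∈ V, r y ∈ T)
    (hfix : ∀ y ∈ smoothComponent 𝓘(ℝ, E) (V ∩ T) y₀, r y = y) :
    ∃ φ ∈ IsManifold.maximalAtlas 𝓘(ℝ, E) ∞ Q, y₀ ∈ φ.source ∧ ∃ W : Submodule ℝ E,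
      φ.extend 𝓘(ℝ, E) '' smoothComponent 𝓘(ℝ, E) (φ.source ∩ T) y₀ =
        (φ.extend 𝓘(ℝ, E)).target ∩ W := by
  have hi : ∀ᶠ y in 𝓝 y₀, r (r y) = r y := by
    have h1 : IsOpen (V ∩ r ⁻¹' V) := hr.continuousOn.isOpen_inter_preimage hV hV
    filter_upwards [eventually_mem_smoothComponent (E := E) h1
      ⟨hy₀, by rwa [mem_preimage, hry]⟩] with y hy
    -- `r` carries a curve from `y₀` to `y` into `T`, so `r y` lies in the component on which `r` is
    -- the identity.
    have h2 := map_mem_smoothComponent hy (J := 𝓘(ℝ, E)) (B := V ∩ T) hV hr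
      inter_subset_left fun z hz => ⟨hz.2, hrT z hz.1⟩
    rw [hry] at h2
    exact hfix _ h2
  obtain ⟨φ, hφ, h0, hsub, hφ0, ⟨ε, hε, hball⟩, W, hW⟩ :=
    exists_chart_fixedPoints_manifold hV hy₀ hr hry hi
  refine ⟨φ, hφ, h0, W, ?_⟩
  simp only [mfld_simps]
  ext z
  constructor
  · rintro ⟨y, hy, rfl⟩
    have hyS := (mem_of_mem_smoothComponent hy).1
    exact ⟨φ.map_source hyS, (hW y hyS).1 (hfix y
      (smoothComponent_mono (inter_subset_inter_left T hsub) y₀ hy))⟩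
  · rintro ⟨hz, hzW⟩
    refine ⟨φ.symm z, ?_, φ.right_inv hz⟩
    -- The slice of a ball is star-shaped, so each of its points is joined to `0` inside the slice,
    -- which consists of fixed points of `r` and hence maps into `T`.
    have hstar : StarConvex ℝ 0 (φ.target ∩ W) := by
      rw [hball]
      exact ((convex_ball _ _).starConvex (Metric.mem_ball_self hε)).inter
        (W.convex.starConvex W.zero_mem)
    have h1 := map_mem_smoothComponent (mem_smoothComponent_of_starConvex hstar ⟨hz, hzW⟩)
      (J := 𝓘(ℝ, E)) (B := φ.source ∩ T) φ.open_target (contMDiffOn_symm_of_mem_maximalAtlas hφ)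
      inter_subset_left fun w hw => by
        have hy := φ.map_target hw.1
        refine ⟨hy, ?_⟩
        have h1 : r (φ.symm w) = φ.symm w := (hW _ hy).2 (by rw [φ.right_inv hw.1]; exact hw.2)
        rw [← h1]
        exact hrT _ (hsub hy)
    have h2 : φ.symm 0 = y₀ := by rw [← hφ0, φ.left_inv h0]
    rwa [h2] at h1

end RetractionManifold

/-! ### Images of submanifolds under maps with local sections -/

section Projection

variable {E : Type*} [NormedAddCommGroup E] [NormedSpace ℝ E]
  {Q : Type*} [TopologicalSpace Q] [ChartedSpace E Q]
  {E' : Type*} [NormedAddCommGroup E'] [NormedSpace ℝ E'] [FiniteDimensional ℝ E']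
  {H' : Type*} [TopologicalSpace H'] {J : ModelWithCorners ℝ E' H'} [J.Boundaryless]
  {X : Type*} [TopologicalSpace X] [ChartedSpace H' X]

/-- Let `p : X → Q` map `S` into `T`, with a section `σ` around `y₀` that maps `T` into `S`. Then an
adapted chart for `S` at `σ y₀` gives rise to a local retraction of `Q` onto `T`. -/
theorem exists_retraction_of_section {S : Set X} {T : Set Q} {p : X → Q} {σ : Q → X}
    {V : Set Q} (hp : ContMDiff J 𝓘(ℝ, E) ∞ p) (hST : MapsTo p S T)
    (hV : IsOpen V) {y₀ : Q} (hy₀ : y₀ ∈ V) (hσ : ContMDiffOn 𝓘(ℝ, E) J ∞ σ V)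
    (hpσ : ∀ y ∈ V, p (σ y) = y)
    {ψ : OpenPartialHomeomorph X H'} (hψ : ψ ∈ IsManifold.maximalAtlas J ∞ X)
    (hψ₀ : σ y₀ ∈ ψ.source) {W : Submodule ℝ E'} (hW₀ : ψ.extend J (σ y₀) ∈ W)
    (hW : ∀ z ∈ (ψ.extend J).target ∩ W, (ψ.extend J).symm z ∈ S) :
    ∃ r : Q → Q, ∃ V' ⊆ V, IsOpen V' ∧ y₀ ∈ V' ∧ ContMDiffOn 𝓘(ℝ, E) 𝓘(ℝ, E) ∞ r V' ∧
      r y₀ = y₀ ∧ (∀ y ∈ V', r y ∈ T) ∧ (∀ y ∈ V', σ y ∈ ψ.source) ∧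
      ∀ y ∈ V', ψ.extend J (σ y) ∈ W → r y = y := by
  obtain ⟨P, hP⟩ := Submodule.ClosedComplemented.of_finiteDimensional W
  have hT : IsOpen (ψ.extend J).target := ψ.isOpen_extend_target
  -- In the chart `ψ`, this is `σ y` moved onto the slice by a linear projection; the retraction is
  -- `p` of the resulting point of `S`.
  let a : Q → E' := fun y => (P (ψ.extend J (σ y)) : E')
  have haW : ∀ y, ψ.extend J (σ y) ∈ W → a y = ψ.extend J (σ y) := fun y hy =>
    congrArg Subtype.val (hP ⟨_, hy⟩)
  have hV₁ : IsOpen (V ∩ σ ⁻¹' ψ.source) := hσ.continuousOn.isOpen_inter_preimage hV ψ.open_source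
  have ha : ContMDiffOn 𝓘(ℝ, E) 𝓘(ℝ, E') ∞ a (V ∩ σ ⁻¹' ψ.source) := by
    have h1 : ContDiff ℝ ∞ fun z => (P z : E') := (W.subtypeL ∘L P).contDiff
    exact h1.contMDiff.comp_contMDiffOn
      ((ψ.contMDiffOn_extend hψ).comp (hσ.mono inter_subset_left) fun y hy => hy.2)
  -- The projected point may leave the chart, so the domain is shrunk once more.
  have hV₂ : IsOpen (V ∩ σ ⁻¹' ψ.source ∩ a ⁻¹' (ψ.extend J).target) :=
    ha.continuousOn.isOpen_inter_preimage hV₁ hT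
  have hsymm : ContMDiffOn 𝓘(ℝ, E') J ∞ (ψ.extend J).symm (ψ.extend J).target := by
    refine (contMDiffOn_extend_symm hψ).mono fun z hz => ?_
    rw [ψ.extend_target_eq_image_source] at hz
    obtain ⟨x, hx, rfl⟩ := hz
    exact ⟨ψ x, ψ.map_source hx, rfl⟩
  have hfix : ∀ y ∈ V ∩ σ ⁻¹' ψ.source, ψ.extend J (σ y) ∈ W →
      p ((ψ.extend J).symm (a y)) = y := fun y hy hyW => by
    rw [haW y hyW, ψ.extend_left_inv hy.2, hpσ y hy.1]
  refine ⟨fun y => p ((ψ.extend J).symm (a y)), _, fun y hy => hy.1.1, hV₂, ⟨⟨hy₀, hψ₀⟩, ?_⟩,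
    hp.comp_contMDiffOn (hsymm.comp (ha.mono inter_subset_left) fun y hy => hy.2),
    hfix _ ⟨hy₀, hψ₀⟩ hW₀, fun y hy => hST (hW _ ⟨hy.2, (P _).2⟩), fun y hy => hy.1.2,
    fun y hy => hfix y hy.1⟩
  rw [mem_preimage, haW y₀ hW₀]
  exact (ψ.extend J).map_source (by rwa [ψ.extend_source])

variable [CompleteSpace E] [IsManifold 𝓘(ℝ, E) ∞ Q]

/-- The image of a submanifold under a smooth map is a submanifold, if the map has local sections
that map the image into the submanifold. -/
theorem IsSubmanifold.of_sections {S : Set X} {T : Set Q} (hS : IsSubmanifold J S) {p : X → Q}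
    (hp : ContMDiff J 𝓘(ℝ, E) ∞ p) (hST : p '' S = T)
    (hsec : ∀ y₀ ∈ T, ∃ σ : Q → X, ∃ V, IsOpen V ∧ y₀ ∈ V ∧ ContMDiffOn 𝓘(ℝ, E) J ∞ σ V ∧
      (∀ y ∈ V, p (σ y) = y) ∧ MapsTo σ (V ∩ T) S) :
    IsSubmanifold 𝓘(ℝ, E) T := by
  have hmaps : MapsTo p S T := fun x hx => hST ▸ mem_image_of_mem p hx
  refine ⟨fun y₀ hy₀ => ?_, ?_⟩
  · obtain ⟨σ, V, hV, hyV, hσ, hpσ, hσT⟩ := hsec y₀ hy₀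
    obtain ⟨ψ, hψ, hψ₀, W, hW⟩ := hS.1 (σ y₀) (hσT ⟨hyV, hy₀⟩)
    have hmemW : ∀ x ∈ smoothComponent J (ψ.source ∩ S) (σ y₀), ψ.extend J x ∈ W := fun x hx =>
      (hW.subset (mem_image_of_mem _ hx)).2
    obtain ⟨r, V', hV'V, hV', hyV', hr, hry, hrT, hψs, hfix⟩ :=
      exists_retraction_of_section hp hmaps hV hyV hσ hpσ hψ hψ₀
        (hmemW _ (mem_smoothComponent_self ⟨hψ₀, hσT ⟨hyV, hy₀⟩⟩)) (fun z hz => by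
          obtain ⟨x, hx, rfl⟩ := hW.superset hz
          have h1 := mem_of_mem_smoothComponent hx
          rw [ψ.extend_left_inv h1.1]
          exact h1.2)
    refine exists_initial_slice_of_retraction hV' hyV' hr hry hrT fun y hy => ?_
    -- `σ` lifts curves in `T` to curves in `S` within the chart, so the lift of the component of
    -- `y₀` stays on the one sheet described by `W`.
    exact hfix y (mem_of_mem_smoothComponent hy).1 (hmemW _
      (map_mem_smoothComponent hy hV' (hσ.mono hV'V) inter_subset_left fun z hz =>
        ⟨hψs z hz.1, hσT ⟨hV'V hz.1, hz.2⟩⟩))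
  · obtain ⟨D, hD, hDS, hcomp⟩ := hS.2
    refine ⟨p '' D, hD.image p, fun y hy => ?_, fun y hy => ?_⟩
    · obtain ⟨d, hd, rfl⟩ := hy
      exact hmaps (hDS hd)
    · rw [← hST] at hy
      obtain ⟨x, hx, rfl⟩ := hy
      obtain ⟨d, hd, hxd⟩ := hcomp x hx
      exact ⟨p d, mem_image_of_mem p hd,
        map_mem_smoothComponent hxd isOpen_univ hp.contMDiffOn (subset_univ _) hmaps⟩

theorem IsEmbeddedSubmanifold.of_sections {S : Set X} {T : Set Q} (hS : IsEmbeddedSubmanifold J S)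
    {p : X → Q} (hp : ContMDiff J 𝓘(ℝ, E) ∞ p) (hST : p '' S = T)
    (hsec : ∀ y₀ ∈ T, ∃ σ : Q → X, ∃ V, IsOpen V ∧ y₀ ∈ V ∧ ContMDiffOn 𝓘(ℝ, E) J ∞ σ V ∧
      (∀ y ∈ V, p (σ y) = y) ∧ MapsTo σ (V ∩ T) S) :
    IsEmbeddedSubmanifold 𝓘(ℝ, E) T := by
  have hmaps : MapsTo p S T := fun x hx => hST ▸ mem_image_of_mem p hx
  intro y₀ hy₀
  obtain ⟨σ, V, hV, hyV, hσ, hpσ, hσT⟩ := hsec y₀ hy₀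
  obtain ⟨ψ, hψ, hψ₀, W, hW⟩ := hS (σ y₀) (hσT ⟨hyV, hy₀⟩)
  have hmemW : ∀ x ∈ ψ.source ∩ S, ψ.extend J x ∈ W := fun x hx =>
    (hW.subset (mem_image_of_mem _ hx)).2
  obtain ⟨r, V', hV'V, hV', hyV', hr, hry, hrT, hψs, hfix⟩ :=
    exists_retraction_of_section hp hmaps hV hyV hσ hpσ hψ hψ₀
      (hmemW _ ⟨hψ₀, hσT ⟨hyV, hy₀⟩⟩) (fun z hz => by
        obtain ⟨x, hx, rfl⟩ := hW.superset hz
        rw [ψ.extend_left_inv hx.1]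
        exact hx.2)
  exact exists_slice_of_retraction hV' hyV' hr hry hrT fun y hy =>
    hfix y hy.1 (hmemW _ ⟨hψs y hy.1, hσT ⟨hV'V hy.1, hy.2⟩⟩)

end Projection

/-! ### Local sections of submersions -/

section Sections

variable {E : Type*} [NormedAddCommGroup E] [NormedSpace ℝ E]
  {M : Type*} [TopologicalSpace M] [ChartedSpace E M]
  {E' : Type*} [NormedAddCommGroup E'] [NormedSpace ℝ E']
  {Q : Type*} [TopologicalSpace Q] [ChartedSpace E' Q]

theorem exists_local_section {q : M → Q} {x : M}
    (hq : Manifold.IsSubmersionAt 𝓘(ℝ, E) 𝓘(ℝ, E') ∞ q x) :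
    ∃ σ : Q → M, ∃ V, IsOpen V ∧ q x ∈ V ∧ ContMDiffOn 𝓘(ℝ, E') 𝓘(ℝ, E) ∞ σ V ∧
      (∀ y ∈ V, q (σ y) = y) ∧ σ (q x) = x := by
  have hxφ := hq.mem_domChart_source
  have hxψ := hq.mem_codChart_source
  have hφ := hq.domChart_mem_maximalAtlas
  have hψ := hq.codChart_mem_maximalAtlas
  have hsub := hq.source_subset_preimage_source
  have hw := hq.writtenInCharts
  generalize hq.domChart = φ at *
  generalize hq.codChart = ψ at *
  generalize hq.equiv = e at *
  simp only [mfld_simps] at hw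
  have hwx : ψ (q x) = (e (φ x)).1 := by
    have := hw (φ.map_source hxφ)
    simpa [φ.left_inv hxφ] using this
  -- In submersion charts `q` is a linear projection; the section freezes the complementary
  -- coordinate at its value at `x`.
  let a : Q → E := fun y => e.symm (ψ y, (e (φ x)).2)
  have ha : ContMDiffOn 𝓘(ℝ, E') 𝓘(ℝ, E) ∞ a ψ.source := by
    have h1 : ContDiff ℝ ∞ fun z : E' => e.symm (z, (e (φ x)).2) :=
      e.symm.contDiff.comp (contDiff_id.prodMk contDiff_const)
    exact h1.contMDiff.comp_contMDiffOn (contMDiffOn_of_mem_maximalAtlas hψ)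
  have hax : a (q x) = φ x := by
    simp only [a]
    rw [hwx, Prod.mk.eta, e.symm_apply_apply]
  refine ⟨φ.symm ∘ a, ψ.source ∩ a ⁻¹' φ.target,
    ha.continuousOn.isOpen_inter_preimage ψ.open_source φ.open_target,
    ⟨hxψ, by rw [mem_preimage, hax]; exact φ.map_source hxφ⟩,
    (contMDiffOn_symm_of_mem_maximalAtlas hφ).comp (ha.mono inter_subset_left) fun y hy => hy.2,
    fun y hy => ?_, by rw [Function.comp_apply, hax, φ.left_inv hxφ]⟩
  have h1 := hw hy.2
  simp only [Function.comp_apply, a, e.apply_symm_apply] at h1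
  exact ψ.injOn (hsub (φ.map_target hy.2)) hy.1 h1

end Sections

/-! ### Tangent vectors of subsets -/

section Tangent

variable {E : Type*} [NormedAddCommGroup E] [NormedSpace ℝ E]
  {H : Type*} [TopologicalSpace H] {I : ModelWithCorners ℝ E H}
  {X : Type*} [TopologicalSpace X] [ChartedSpace H X]
  {E' : Type*} [NormedAddCommGroup E'] [NormedSpace ℝ E']
  {H' : Type*} [TopologicalSpace H'] {J : ModelWithCorners ℝ E' H'}
  {Y : Type*} [TopologicalSpace Y] [ChartedSpace H' Y]

theorem mem_tangentTo_map {A : Set X} {B : Set Y} {x : X} {v : TangentSpace I x}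
    (hv : v ∈ tangentTo I A x) {f : X → Y} (hf : ContMDiff I J ∞ f) (hAB : MapsTo f A B) :
    mfderiv I J f x v ∈ tangentTo J B (f x) := by
  obtain ⟨γ, hγ, h⟩ := hv
  refine ⟨f ∘ γ, hγ.comp isOpen_univ hf.contMDiffOn (subset_univ _) hAB, ?_⟩
  rw [tangentMap_comp_at _ (hf.mdifferentiable (by simp) _) (hγ.1.mdifferentiable (by simp) _), h]
  rfl

/-- All tangent spaces are the model space `E` by definition, so vectors at propositionally equal
base points can be compared there. -/
theorem mem_tangentTo_of_eq {A : Set X} {x y : X} (h : x = y) {v : TangentSpace I x}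
    {w : TangentSpace I y} (hvw : (show E from v) = (show E from w)) (hv : v ∈ tangentTo I A x) :
    w ∈ tangentTo I A y := by
  subst h
  exact (show v = w from hvw) ▸ hv

theorem mem_tangentTo_prod {A : Set X} {B : Set Y} {x : X} {y : Y} {v : TangentSpace I x}
    {w : TangentSpace J y} (hv : v ∈ tangentTo I A x) (hw : w ∈ tangentTo J B y) :
    (show TangentSpace (I.prod J) (x, y) from (v, w)) ∈ tangentTo (I.prod J) (A ×ˢ B) (x, y) := by
  obtain ⟨γ, hγ, h⟩ := hv
  obtain ⟨δ, hδ, h'⟩ := hw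
  refine ⟨fun t => (γ t, δ t), ⟨hγ.1.prodMk hδ.1, fun t => ⟨hγ.2 t, hδ.2 t⟩⟩, ?_⟩
  obtain rfl : γ 0 = x := congrArg Bundle.TotalSpace.proj h
  obtain rfl : δ 0 = y := congrArg Bundle.TotalSpace.proj h'
  have h1 : mfderiv 𝓘(ℝ, ℝ) I γ 0 (1 : ℝ) = v := by
    simpa [tangentMap] using h
  have h2 : mfderiv 𝓘(ℝ, ℝ) J δ 0 (1 : ℝ) = w := by
    simpa [tangentMap] using h'
  simp only [tangentMap]
  rw [mfderiv_prodMk (hγ.1.mdifferentiable (by simp) _) (hδ.1.mdifferentiable (by simp) _)]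
  subst h1 h2
  rfl

theorem mem_tangentTo_univ [IsManifold I ∞ X] [I.Boundaryless] (x : X) (v : TangentSpace I x) :
    v ∈ tangentTo I univ x := by
  set c := extChartAt I x
  obtain ⟨ε, hε, hball⟩ := Metric.mem_nhds_iff.1 (extChartAt_target_mem_nhds (I := I) x)
  let v' : E := v
  obtain ⟨δ, hδ, hδε⟩ : ∃ δ > 0, δ * ‖v'‖ < ε := by
    refine ⟨ε / (‖v'‖ + 1), by positivity, ?_⟩
    rw [div_mul_eq_mul_div, div_lt_iff₀ (by positivity)]
    nlinarith [norm_nonneg v']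
  -- A straight line would leave the chart; `δ sin(t / δ)` has derivative `1` at `0` and is bounded
  -- by `δ`.
  let k : ℝ → E := fun t => c x + (δ * Real.sin (t / δ)) • v'
  have hk : ContDiff ℝ ∞ k := contDiff_const.add
    ((contDiff_const.mul (Real.contDiff_sin.comp (contDiff_id.div_const δ))).smul contDiff_const)
  have hkt : ∀ t, k t ∈ c.target := by
    intro t
    refine hball ?_
    rw [Metric.mem_ball, dist_eq_norm]
    simp only [k, c, add_sub_cancel_left, norm_smul, norm_mul, Real.norm_eq_abs, abs_of_pos hδ]
    calc δ * |Real.sin (t / δ)| * ‖v'‖ ≤ δ * 1 * ‖v'‖ := by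
          gcongr
          exact Real.abs_sin_le_one _
      _ < ε := by rwa [mul_one]
  have hk0 : k 0 = c x := by simp [k]
  have hkd : HasDerivAt k v' 0 := by
    have h1 : HasDerivAt (fun t : ℝ => δ * Real.sin (t / δ)) (δ * (Real.cos (0 / δ) * (1 / δ))) 0 :=
      ((Real.hasDerivAt_sin _).comp (0 : ℝ) ((hasDerivAt_id (0 : ℝ)).div_const δ)).const_mul δ
    have h2 := (h1.smul_const v').const_add (c x)
    exact HasDerivAt.congr_deriv (f := k) h2 (by simp [hδ.ne'])
  have hcs : ContMDiffOn 𝓘(ℝ, E) I ∞ c.symm c.target := contMDiffOn_extChartAt_symm x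
  have hγ : ContMDiff 𝓘(ℝ, ℝ) I ∞ (c.symm ∘ k) := fun t =>
    ((hcs.contMDiffAt ((isOpen_extChartAt_target x).mem_nhds (hkt t))).comp t
      hk.contMDiff.contMDiffAt)
  refine ⟨c.symm ∘ k, ⟨hγ, fun _ => mem_univ _⟩, ?_⟩
  have h0 : c.symm (c x) = x := extChartAt_to_inv x
  have hder : (show E from mfderiv 𝓘(ℝ, ℝ) I (c.symm ∘ k) 0 (1 : ℝ)) = v' := by
    have h1 : MDifferentiableAt 𝓘(ℝ, E) I c.symm (c x) :=
      (hcs.contMDiffAt ((isOpen_extChartAt_target x).mem_nhds (mem_extChartAt_target x)))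
        |>.mdifferentiableAt (by simp)
    have e := mfderiv_comp_apply_of_eq _ h1 (hk.contMDiff.mdifferentiable (by simp) _) hk0 (1 : ℝ)
    -- The tangent space at `x` is identified with `E` by this very chart, so the inverse chart has
    -- identity derivative at `c x`.
    have h2 := mfderivWithin_range_extChartAt_symm (I := I) (x := x)
    rw [I.range_eq_univ, mfderivWithin_univ] at h2
    have h3 : mfderiv 𝓘(ℝ, ℝ) 𝓘(ℝ, E) k 0 (1 : ℝ) = v' := by
      rw [mfderiv_eq_fderiv]
      exact hkd.deriv
    refine Eq.trans e ?_
    rw [h3]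
    exact congrArg (fun B : E →L[ℝ] E => B v') h2
  have : (c.symm ∘ k) 0 = x := by rw [Function.comp_apply, hk0, h0]
  generalize c.symm ∘ k = γ at *
  subst this
  exact congrArg (Bundle.TotalSpace.mk (γ 0)) hder

end Tangent

/-! ### Infinitesimal actions of subgroups -/

section LieGroupCalculus

variable {E : Type*} [NormedAddCommGroup E] [NormedSpace ℝ E]
  {H : Type*} [TopologicalSpace H] {I : ModelWithCorners ℝ E H}
  {G : Type*} [TopologicalSpace G] [ChartedSpace H G] [Group G] [LieGroup I ∞ G]
  {E' : Type*} [NormedAddCommGroup E'] [NormedSpace ℝ E']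
  {H' : Type*} [TopologicalSpace H'] {J : ModelWithCorners ℝ E' H'}
  {L : Type*} [TopologicalSpace L] [ChartedSpace H' L]

theorem mfderiv_mul_apply {f g : L → G} {x : L} (hf : MDifferentiableAt J I f x)
    (hg : MDifferentiableAt J I g x) (v : TangentSpace J x) :
    (show E from mfderiv J I (fun y => f y * g y) x v) =
      (show E from mfderiv I I (fun h => h * g x) (f x) (mfderiv J I f x v)) +
        (show E from mfderiv I I (fun h => f x * h) (g x) (mfderiv J I g x v)) := by
  have hm : MDifferentiableAt (I.prod I) I (fun p : G × G => p.1 * p.2) (f x, g x) :=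
    (contMDiff_mul I ∞).mdifferentiable (by simp) _
  have h1 : mfderiv J I ((fun p : G × G => p.1 * p.2) ∘ fun y => (f y, g y)) x v = _ :=
    mfderiv_comp_apply x hm (hf.prodMk hg) v
  have h2 := mfderiv_prod_eq_add_apply (v := mfderiv J (I.prod I) (fun y => (f y, g y)) x v) hm
  rw [← h1] at h2
  rw [mfderiv_prodMk hf hg] at h2
  exact h2

variable [Group L]

/-- Differentiating the inverse is avoided: multiplying the orbit map on the right by `(ι l).2`
gives `τ((ι l).1) k`, and the product rule is solved for the derivative of the orbit map. -/
theorem mfderiv_twistedAct {τ : G ≃* G} (hτ : ContMDiff I I ∞ τ) {ι : L →* G × G}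
    (hι : ContMDiff J (I.prod I) ∞ ι) (k : G) (ζ : GroupLieAlgebra J L) :
    (show E from mfderiv J I (fun l => twistedAct τ (ι l) k) 1 ζ) =
      (show E from rightField I k (lieMap I I τ.toMonoidHom
        (lieMap J I ((MonoidHom.fst G G).comp ι) ζ))) -
      (show E from leftField I k (lieMap J I ((MonoidHom.snd G G).comp ι) ζ)) := by
  have h1 : ContMDiff J I ∞ fun l => (ι l).1 := contMDiff_fst.comp hι
  have h2 : ContMDiff J I ∞ fun l => (ι l).2 := contMDiff_snd.comp hι
  have hf : ContMDiff J I ∞ fun l => twistedAct τ (ι l) k :=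
    ((hτ.comp h1).mul contMDiff_const).mul h2.inv
  have hone : twistedAct τ (ι 1) k = k := by simp [twistedAct]
  have e1 := mfderiv_mul_apply (hf.mdifferentiable (by simp) 1) (h2.mdifferentiable (by simp) 1) ζ
  have hfun : (fun l => twistedAct τ (ι l) k * (ι l).2) =
      (fun g => g * k) ∘ τ ∘ fun l => (ι l).1 := by
    ext l
    simp [twistedAct]
  have hR : MDifferentiableAt I I (fun g : G => g * k) 1 :=
    contMDiff_mul_right.mdifferentiable (n := ∞) (by simp) _
  have e2 : (show E from mfderiv J I (fun l => twistedAct τ (ι l) k * (ι l).2) 1 ζ) =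
      (show E from rightField I k (lieMap I I τ.toMonoidHom
        (lieMap J I ((MonoidHom.fst G G).comp ι) ζ))) := by
    rw [hfun]
    have h3 : MDifferentiableAt J I (τ ∘ fun l => (ι l).1) 1 :=
      (hτ.comp h1).mdifferentiable (by simp) _
    have e := mfderiv_comp_apply_of_eq (1 : L) hR h3 (by simp) ζ
    have e' := mfderiv_comp_apply_of_eq (y := (1 : G)) (1 : L) (hτ.mdifferentiable (by simp) _)
      (h1.mdifferentiable (by simp) _) (by simp) ζ
    refine Eq.trans e ?_
    rw [e']
    rfl
  have e3 : ∀ (w : E), (show E from mfderiv I I (fun h : G => h * (ι (1 : L)).2)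
      (twistedAct τ (ι 1) k) w) = w := by
    intro w
    have : (fun h : G => h * (ι (1 : L)).2) = id := by
      ext h
      simp
    rw [this, mfderiv_id]
    rfl
  have e4 : ∀ w : E, (show E from mfderiv I I (fun h : G => twistedAct τ (ι 1) k * h)
      (ι (1 : L)).2 w) = (show E from leftField I k w) := by
    intro w
    rw [hone, map_one]
    rfl
  rw [← e2, e1]
  refine eq_sub_of_add_eq ?_
  congr 1
  · exact (e3 _).symm
  · exact (e4 _).symm

/-- A subset of `G` that is stable under a twisted action is tangent to the generating vector fields
of the action. -/
theorem IsHatStable.generator_mem_tangentTo [LieGroup J ∞ L] [J.Boundaryless] {τ : G ≃* G}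
    (hτ : ContMDiff I I ∞ τ) {ι : L →* G × G} (hι : ContMDiff J (I.prod I) ∞ ι) {K : Set G}
    (hK : IsHatStable ι τ K) {k : G} (hk : k ∈ K) (ζ : GroupLieAlgebra J L) :
    rightField I k (lieMap I I τ.toMonoidHom (lieMap J I ((MonoidHom.fst G G).comp ι) ζ)) -
      leftField I k (lieMap J I ((MonoidHom.snd G G).comp ι) ζ) ∈ tangentTo I K k := by
  have h1 : ContMDiff J I ∞ fun l => (ι l).1 := contMDiff_fst.comp hι
  have h2 : ContMDiff J I ∞ fun l => (ι l).2 := contMDiff_snd.comp hι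
  have hf : ContMDiff J I ∞ fun l => twistedAct τ (ι l) k :=
    ((hτ.comp h1).mul contMDiff_const).mul h2.inv
  have h := mem_tangentTo_map (B := K) (mem_tangentTo_univ (1 : L) ζ) hf fun l _ => hK l k hk
  exact mem_tangentTo_of_eq (by simp [twistedAct]) (mfderiv_twistedAct hτ hι k ζ) h

end LieGroupCalculus

/-! ### Descending bivector fields along submersions -/

section Descent

variable {E : Type*} [NormedAddCommGroup E] [NormedSpace ℝ E]
  {M : Type*} [TopologicalSpace M] [ChartedSpace E M]
  {E' : Type*} [NormedAddCommGroup E'] [NormedSpace ℝ E']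
  {Q : Type*} [TopologicalSpace Q] [ChartedSpace E' Q]

/-- Locally `f = (f ∘ q) ∘ σ` for a smooth section `σ` of `q`. -/
theorem contMDiff_of_comp_submersion {F : Type*} [NormedAddCommGroup F] [NormedSpace ℝ F]
    {q : M → Q} (hq : Manifold.IsSubmersion 𝓘(ℝ, E) 𝓘(ℝ, E') ∞ q)
    (hsurj : Function.Surjective q) {f : Q → F}
    (hf : ContMDiff 𝓘(ℝ, E) 𝓘(ℝ, F) ∞ (f ∘ q)) : ContMDiff 𝓘(ℝ, E') 𝓘(ℝ, F) ∞ f := by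
  intro y
  obtain ⟨x, rfl⟩ := hsurj y
  obtain ⟨σ, V, hV, hxV, hσ, hqσ, -⟩ := exists_local_section (hq.isSubmersionAt x)
  refine ((hf.comp_contMDiffOn hσ).contMDiffAt (hV.mem_nhds hxV)).congr_of_eventuallyEq ?_
  filter_upwards [hV.mem_nhds hxV] with y hy
  simp [hqσ y hy]

theorem diff_comp {f : Q → ℝ} {q : M → Q} (hf : ContMDiff 𝓘(ℝ, E') 𝓘(ℝ, ℝ) ∞ f)
    (hq : ContMDiff 𝓘(ℝ, E) 𝓘(ℝ, E') ∞ q) (x : M) :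
    diff 𝓘(ℝ, E) (f ∘ q) x =
      diff 𝓘(ℝ, E') f (q x) ∘ₗ (mfderiv 𝓘(ℝ, E) 𝓘(ℝ, E') q x).toLinearMap := by
  ext v
  exact mfderiv_comp_apply x (hf.mdifferentiable (by simp) _) (hq.mdifferentiable (by simp) _) v

variable {π : BivectorField 𝓘(ℝ, E) M} {q : M → Q}

theorem BivectorField.DescendsTo.bracket_comp {π' : BivectorField 𝓘(ℝ, E') Q}
    (h : π.DescendsTo q π') (hq : ContMDiff 𝓘(ℝ, E) 𝓘(ℝ, E') ∞ q) {f g : Q → ℝ}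
    (hf : ContMDiff 𝓘(ℝ, E') 𝓘(ℝ, ℝ) ∞ f) (hg : ContMDiff 𝓘(ℝ, E') 𝓘(ℝ, ℝ) ∞ g) :
    π'.bracket f g ∘ q = π.bracket (f ∘ q) (g ∘ q) := by
  ext x
  simp only [Function.comp_apply, BivectorField.bracket, diff_comp hf hq, diff_comp hg hq]
  exact h x _ _

theorem BivectorField.DescendsTo.halfSchouten_comp {π' : BivectorField 𝓘(ℝ, E') Q}
    (h : π.DescendsTo q π') (hq : ContMDiff 𝓘(ℝ, E) 𝓘(ℝ, E') ∞ q) {f₁ f₂ f₃ : Q → ℝ}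
    (h₁ : ContMDiff 𝓘(ℝ, E') 𝓘(ℝ, ℝ) ∞ f₁) (h₂ : ContMDiff 𝓘(ℝ, E') 𝓘(ℝ, ℝ) ∞ f₂)
    (h₃ : ContMDiff 𝓘(ℝ, E') 𝓘(ℝ, ℝ) ∞ f₃) (x : M) :
    π'.halfSchouten f₁ f₂ f₃ (q x) = π.halfSchouten (f₁ ∘ q) (f₂ ∘ q) (f₃ ∘ q) x := by
  simp only [BivectorField.halfSchouten, ← h.bracket_comp hq h₁ h₂, ← h.bracket_comp hq h₂ h₃,
    ← h.bracket_comp hq h₃ h₁]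
  have s₁ : ContMDiff 𝓘(ℝ, E') 𝓘(ℝ, ℝ) ∞ (π'.bracket f₂ f₃) := π'.smooth _ _ h₂ h₃
  have s₂ : ContMDiff 𝓘(ℝ, E') 𝓘(ℝ, ℝ) ∞ (π'.bracket f₃ f₁) := π'.smooth _ _ h₃ h₁
  have s₃ : ContMDiff 𝓘(ℝ, E') 𝓘(ℝ, ℝ) ∞ (π'.bracket f₁ f₂) := π'.smooth _ _ h₁ h₂
  rw [← h.bracket_comp hq h₁ s₁, ← h.bracket_comp hq h₂ s₂, ← h.bracket_comp hq h₃ s₃]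
  rfl

theorem BivectorField.DescendsTo.unique {π₁ π₂ : BivectorField 𝓘(ℝ, E') Q}
    (h₁ : π.DescendsTo q π₁) (h₂ : π.DescendsTo q π₂) (hq : Function.Surjective q) : π₁ = π₂ := by
  ext y α β
  obtain ⟨x, rfl⟩ := hq y
  exact (h₁ x α β).trans (h₂ x α β).symm

variable (π q) in
/-- The push-forward of `π_x` along `q`, as a bilinear form on the model space. -/
def pushForwardAt (x : M) : Module.Dual ℝ E' →ₗ[ℝ] Module.Dual ℝ E' →ₗ[ℝ] ℝ :=
  let T : Module.Dual ℝ E' →ₗ[ℝ] Cotangent 𝓘(ℝ, E) x :=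
    (show TangentSpace 𝓘(ℝ, E) x →ₗ[ℝ] E' from
      (mfderiv 𝓘(ℝ, E) 𝓘(ℝ, E') q x).toLinearMap).dualMap
  (π.toFun x).compl₁₂ T T

/-- A bivector field descends along a surjective submersion if its push-forward is constant along
the fibres. -/
theorem exists_descendsTo (hq : Manifold.IsSubmersion 𝓘(ℝ, E) 𝓘(ℝ, E') ∞ q)
    (hqs : ContMDiff 𝓘(ℝ, E) 𝓘(ℝ, E') ∞ q)
    (hsurj : Function.Surjective q)
    (hfib : ∀ x x', q x = q x' → pushForwardAt (E' := E') π q x = pushForwardAt π q x') :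
    ∃ π' : BivectorField 𝓘(ℝ, E') Q, π.DescendsTo q π' := by
  -- The descended value is defined through an arbitrary preimage; constancy on fibres makes the
  -- choice immaterial, also for smoothness, which is checked upstairs.
  have key : ∀ x, pushForwardAt π q (Function.surjInv hsurj (q x)) = pushForwardAt π q x :=
    fun x => hfib _ _ (Function.surjInv_eq hsurj _)
  refine ⟨⟨fun y => pushForwardAt (E' := E') π q (Function.surjInv hsurj y), fun y α => ?_,
    fun f g hf hg => ?_⟩, fun x α β => ?_⟩
  · exact π.alternating _ _
  · refine contMDiff_of_comp_submersion hq hsurj ?_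
    refine (π.smooth (f ∘ q) (g ∘ q) (hf.comp hqs) (hg.comp hqs)).congr fun x => ?_
    rw [diff_comp hf hqs, diff_comp hg hqs]
    exact congrArg (fun B : Module.Dual ℝ E' →ₗ[ℝ] Module.Dual ℝ E' →ₗ[ℝ] ℝ =>
      B (diff 𝓘(ℝ, E') f (q x)) (diff 𝓘(ℝ, E') g (q x))) (key x)
  · exact congrArg (fun B : Module.Dual ℝ E' →ₗ[ℝ] Module.Dual ℝ E' →ₗ[ℝ] ℝ => B α β) (key x)

end Descent

/-! ### Orbit spaces of quasi-Poisson manifolds -/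

section OrbitSpaceFibers

variable {G : Type*} [Group G]
  {EM : Type*} [NormedAddCommGroup EM] [NormedSpace ℝ EM]
  {M : Type*} [TopologicalSpace M] [ChartedSpace EM M] [MulAction G M]
  {C : Type*} [Group C]
  {EQ : Type*} [NormedAddCommGroup EQ] [NormedSpace ℝ EQ]
  {Q : Type*} [TopologicalSpace Q] [ChartedSpace EQ Q]
  {ι : C →* G} {q : M → Q}

theorem IsOrbitSpace.map_smul (hq : IsOrbitSpace ι 𝓘(ℝ, EM) 𝓘(ℝ, EQ) q) (c : C) (x : M) :
    q (ι c • x) = q x :=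
  ((hq.fibers x _).2 ⟨c, rfl⟩).symm

/-- From `q ∘ c = q`, the differential of `q` at `x` is that at `c • x` composed with `c_*`, and
`c_*` preserves `π`. -/
theorem IsOrbitSpace.pushForwardAt_eq (hq : IsOrbitSpace ι 𝓘(ℝ, EM) 𝓘(ℝ, EQ) q)
    (hqs : ContMDiff 𝓘(ℝ, EM) 𝓘(ℝ, EQ) ∞ q) {π : BivectorField 𝓘(ℝ, EM) M}
    (hsmul : ∀ g : G, ContMDiff 𝓘(ℝ, EM) 𝓘(ℝ, EM) ∞ fun x : M => g • x)
    (hπ : ∀ g : G, π.DescendsTo (fun x => g • x) π) (x x' : M) (h : q x = q x') :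
    pushForwardAt (E' := EQ) π q x = pushForwardAt π q x' := by
  obtain ⟨c, rfl⟩ := (hq.fibers x x').1 h
  have h1 : q ∘ (fun y => ι c • y) = q := funext (hq.map_smul c)
  have h2 : ∀ v : EM, (show EQ from mfderiv 𝓘(ℝ, EM) 𝓘(ℝ, EQ) q x v) =
      (show EQ from mfderiv 𝓘(ℝ, EM) 𝓘(ℝ, EQ) q (ι c • x)
        (mfderiv 𝓘(ℝ, EM) 𝓘(ℝ, EM) (fun y => ι c • y) x v)) := by
    intro v
    have := mfderiv_comp_apply x (hqs.mdifferentiable (by simp) _)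
      ((hsmul (ι c)).mdifferentiable (by simp) x) v
    refine Eq.trans ?_ this
    rw [h1]
  have h3 : ∀ α : Module.Dual ℝ EQ,
      (α ∘ₗ (show TangentSpace 𝓘(ℝ, EM) x →ₗ[ℝ] EQ from
        (mfderiv 𝓘(ℝ, EM) 𝓘(ℝ, EQ) q x).toLinearMap)) =
      (α ∘ₗ (show TangentSpace 𝓘(ℝ, EM) (ι c • x) →ₗ[ℝ] EQ from
        (mfderiv 𝓘(ℝ, EM) 𝓘(ℝ, EQ) q (ι c • x)).toLinearMap)) ∘ₗ
          (mfderiv 𝓘(ℝ, EM) 𝓘(ℝ, EM) (fun y => ι c • y) x).toLinearMap := by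
    intro α
    refine LinearMap.ext fun v => ?_
    exact congrArg α (h2 v)
  refine LinearMap.ext fun α => LinearMap.ext fun β => ?_
  have h4 := hπ (ι c) x
    (α ∘ₗ (show TangentSpace 𝓘(ℝ, EM) (ι c • x) →ₗ[ℝ] EQ from
        (mfderiv 𝓘(ℝ, EM) 𝓘(ℝ, EQ) q (ι c • x)).toLinearMap))
    (β ∘ₗ (show TangentSpace 𝓘(ℝ, EM) (ι c • x) →ₗ[ℝ] EQ from
        (mfderiv 𝓘(ℝ, EM) 𝓘(ℝ, EQ) q (ι c • x)).toLinearMap))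
  rw [← h3 α, ← h3 β] at h4
  exact h4.symm

end OrbitSpaceFibers

section OrbitSpace

variable {E : Type*} [NormedAddCommGroup E] [NormedSpace ℝ E]
  {G : Type*} [TopologicalSpace G] [ChartedSpace E G] [Group G]
  {EM : Type*} [NormedAddCommGroup EM] [NormedSpace ℝ EM]
  {M : Type*} [TopologicalSpace M] [ChartedSpace EM M] [MulAction G M]
  [ContMDiffSMul 𝓘(ℝ, E) 𝓘(ℝ, EM) ∞ G M]
  {EC : Type*} [NormedAddCommGroup EC] [NormedSpace ℝ EC]
  {C : Type*} [TopologicalSpace C] [ChartedSpace EC C] [Group C]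
  {EQ : Type*} [NormedAddCommGroup EQ] [NormedSpace ℝ EQ]
  {Q : Type*} [TopologicalSpace Q] [ChartedSpace EQ Q]
  {ι : C →* G} {q : M → Q}

/-- `q` is constant along `C`-orbits, so it kills their velocities. -/
theorem IsOrbitSpace.mfderiv_infAction (hq : IsOrbitSpace ι 𝓘(ℝ, EM) 𝓘(ℝ, EQ) q)
    (hqs : ContMDiff 𝓘(ℝ, EM) 𝓘(ℝ, EQ) ∞ q) (hι : ContMDiff 𝓘(ℝ, EC) 𝓘(ℝ, E) ∞ ι)
    (x : M) (ζ : GroupLieAlgebra 𝓘(ℝ, EC) C) :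
    mfderiv 𝓘(ℝ, EM) 𝓘(ℝ, EQ) q x
      (infAction 𝓘(ℝ, E) 𝓘(ℝ, EM) x (lieMap 𝓘(ℝ, EC) 𝓘(ℝ, E) ι ζ)) = 0 := by
  have ha : ContMDiff 𝓘(ℝ, E) 𝓘(ℝ, EM) ∞ fun g : G => g • x :=
    (contMDiff_smul (I := 𝓘(ℝ, E)) (I' := 𝓘(ℝ, EM)) (n := ∞) (G := G) (M := M)).comp
      (contMDiff_id.prodMk contMDiff_const)
  have h1 := mfderiv_comp_apply_of_eq (y := (1 : G)) (1 : C) (ha.mdifferentiable (by simp) _)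
    (hι.mdifferentiable (by simp) _) (map_one ι) ζ
  have h2 := mfderiv_comp_apply_of_eq (y := x) (1 : C) (hqs.mdifferentiable (by simp) _)
    ((ha.comp hι).mdifferentiable (by simp) _) (by simp) ζ
  rw [h1] at h2
  have h3 : (q ∘ (fun g : G => g • x) ∘ ι) = fun _ => q x := by
    ext c
    exact hq.map_smul c x
  have h4 : ∀ v : EC, (show EQ from mfderiv 𝓘(ℝ, EC) 𝓘(ℝ, EQ) (q ∘ (fun g : G => g • x) ∘ ι) 1 v)
      = 0 := by
    intro v
    rw [h3, mfderiv_const]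
    rfl
  have h5 := h2.symm.trans (h4 ζ)
  refine (map_neg (mfderiv 𝓘(ℝ, EM) 𝓘(ℝ, EQ) q x) _).trans ?_
  exact neg_eq_zero.2 h5

theorem IsOrbitSpace.pullback_mem_dualAnnihilator (hq : IsOrbitSpace ι 𝓘(ℝ, EM) 𝓘(ℝ, EQ) q)
    (hqs : ContMDiff 𝓘(ℝ, EM) 𝓘(ℝ, EQ) ∞ q) (hι : ContMDiff 𝓘(ℝ, EC) 𝓘(ℝ, E) ∞ ι)
    (x : M) (α : Cotangent 𝓘(ℝ, EQ) (q x)) :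
    (α ∘ₗ (mfderiv 𝓘(ℝ, EM) 𝓘(ℝ, EQ) q x).toLinearMap) ∘ₗ infAction 𝓘(ℝ, E) 𝓘(ℝ, EM) x ∈
      (LinearMap.range (lieMap 𝓘(ℝ, EC) 𝓘(ℝ, E) ι)).dualAnnihilator := by
  rw [Submodule.mem_dualAnnihilator]
  rintro _ ⟨ζ, rfl⟩
  exact (congrArg α (hq.mfderiv_infAction hqs hι x ζ)).trans (map_zero α)

/-- The Jacobiator pulled back to `M` is `φ` evaluated on three elements of `ann(c)`. -/
theorem IsOrbitSpace.isPoisson [FiniteDimensional ℝ E]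
    (hq : IsOrbitSpace ι 𝓘(ℝ, EM) 𝓘(ℝ, EQ) q)
    (hqs : ContMDiff 𝓘(ℝ, EM) 𝓘(ℝ, EQ) ∞ q) (hι : ContMDiff 𝓘(ℝ, EC) 𝓘(ℝ, E) ∞ ι)
    {s : Tensor2 𝓘(ℝ, E) G} (hC : IsReducing s (LinearMap.range (lieMap 𝓘(ℝ, EC) 𝓘(ℝ, E) ι)))
    {π : BivectorField 𝓘(ℝ, EM) M} (hπ : IsQuasiPoisson s π) {π' : BivectorField 𝓘(ℝ, EQ) Q}
    (h : π.DescendsTo q π') : π'.IsPoisson := by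
  intro f₁ f₂ f₃ h₁ h₂ h₃ y
  obtain ⟨x, rfl⟩ := hq.surjective y
  rw [h.halfSchouten_comp hqs h₁ h₂ h₃, hπ.schouten _ _ _ (h₁.comp hqs) (h₂.comp hqs) (h₃.comp hqs),
    diff_comp h₁ hqs, diff_comp h₂ hqs, diff_comp h₃ hqs]
  exact hC _ (hq.pullback_mem_dualAnnihilator hqs hι x _) _
    (hq.pullback_mem_dualAnnihilator hqs hι x _) _ (hq.pullback_mem_dualAnnihilator hqs hι x _)

end OrbitSpace

/-! ### Level sets of the moment map -/

section MomentMap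

variable {E : Type*} [NormedAddCommGroup E] [NormedSpace ℝ E] [FiniteDimensional ℝ E]
  {G : Type*} [TopologicalSpace G] [ChartedSpace E G] [Group G]
  {EM : Type*} [NormedAddCommGroup EM] [NormedSpace ℝ EM]
  {M : Type*} [TopologicalSpace M] [ChartedSpace EM M] [MulAction G M]
  {s : Tensor2 𝓘(ℝ, E) G} {π : BivectorField 𝓘(ℝ, EM) M} {τ : G ≃* G} {μ : M → G}

/-- The Hamiltonian vector `π^♯ A` is mapped by `μ` to `-½ (ξ^L + τ(ξ)^R)`, where `ξ` is the image
under `s^♯` of the covector `A ∘ ρ`. -/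
theorem IsMomentMap.mfderiv_eq (hμ : IsMomentMap s τ π μ) (hs : IsInvariantSymmetric s) {x : M}
    {v : TangentSpace 𝓘(ℝ, EM) x} {A : Cotangent 𝓘(ℝ, EM) x} (hv : ∀ β, β v = π.toFun x β A) :
    mfderiv 𝓘(ℝ, EM) 𝓘(ℝ, E) μ x v =
      rightField 𝓘(ℝ, E) (μ x) (lieMap 𝓘(ℝ, E) 𝓘(ℝ, E) τ.toMonoidHom
        (sharp s (-(1 / 2 : ℝ) • (A ∘ₗ infAction 𝓘(ℝ, E) 𝓘(ℝ, EM) x)))) +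
      leftField 𝓘(ℝ, E) (μ x)
        (sharp s (-(1 / 2 : ℝ) • (A ∘ₗ infAction 𝓘(ℝ, E) 𝓘(ℝ, EM) x))) := by
  -- Vectors are compared by testing against every covector `γ`; the moment condition computes
  -- `π(μ^*γ, A)`, and symmetry of `s` lets `s^♯` act on `A ∘ ρ`.
  refine (Module.evalEquiv ℝ (TangentSpace 𝓘(ℝ, E) (μ x))).injective (LinearMap.ext fun γ => ?_)
  have h1 := hv (γ ∘ₗ (mfderiv 𝓘(ℝ, EM) 𝓘(ℝ, E) μ x).toLinearMap)
  rw [hμ.moment, hs.symm, ← apply_sharp] at h1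
  change γ _ = γ _
  refine Eq.trans h1 ?_
  simp only [map_smul, LinearMap.comp_apply, LinearMap.add_apply, map_add, smul_eq_mul]
  ring

variable [LieGroup 𝓘(ℝ, E) ∞ G] [IsManifold 𝓘(ℝ, EM) ∞ M]
  {EC' : Type*} [NormedAddCommGroup EC'] [NormedSpace ℝ EC']
  {C' : Type*} [TopologicalSpace C'] [ChartedSpace EC' C'] [Group C'] [LieGroup 𝓘(ℝ, EC') ∞ C']

/-- Hamiltonian vectors of covectors that annihilate the `c`-directions are tangent to the preimage
of a stable subset that meets the graph of the moment map cleanly. -/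
theorem IsMomentMap.mem_tangentTo (hμ : IsMomentMap s τ π μ) (hs : IsInvariantSymmetric s)
    (hτ : ContMDiff 𝓘(ℝ, E) 𝓘(ℝ, E) ∞ τ) {ι' : C' →* G × G}
    (hι' : ContMDiff 𝓘(ℝ, EC') (𝓘(ℝ, E).prod 𝓘(ℝ, E)) ∞ ι')
    {c : Submodule ℝ (GroupLieAlgebra 𝓘(ℝ, E) G)}
    (hC' : lieAlgebraInProd 𝓘(ℝ, EC') ι' = hatAlgebra s c)
    {K : Set G} (hK : IsHatStable ι' τ K)
    (hclean : IntersectCleanly (𝓘(ℝ, E).prod 𝓘(ℝ, EM)) (graph μ) (K ×ˢ (univ : Set M)))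
    {x : M} (hx : μ x ∈ K) {v : TangentSpace 𝓘(ℝ, EM) x} {A : Cotangent 𝓘(ℝ, EM) x}
    (hA : A ∘ₗ infAction 𝓘(ℝ, E) 𝓘(ℝ, EM) x ∈ c.dualAnnihilator)
    (hv : ∀ β, β v = π.toFun x β A) :
    (show TangentSpace (𝓘(ℝ, E).prod 𝓘(ℝ, EM)) (μ x, x) from
      (mfderiv 𝓘(ℝ, EM) 𝓘(ℝ, E) μ x v, v)) ∈
        tangentTo (𝓘(ℝ, E).prod 𝓘(ℝ, EM)) (graph μ ∩ K ×ˢ (univ : Set M)) (μ x, x) := by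
  have hxK : (μ x, x) ∈ graph μ ∩ K ×ˢ (univ : Set M) := ⟨⟨x, rfl⟩, hx, mem_univ _⟩
  rw [hclean.2 _ hxK]
  constructor
  · have h1 := mem_tangentTo_map (B := graph μ) (mem_tangentTo_univ x v)
      (hμ.smooth.prodMk contMDiff_id) fun y _ => ⟨y, rfl⟩
    refine mem_tangentTo_of_eq rfl ?_ h1
    rw [mfderiv_prodMk (hμ.smooth.mdifferentiable (by simp) _) mdifferentiableAt_id, mfderiv_id]
    rfl
  · refine mem_tangentTo_prod ?_ (mem_tangentTo_univ x v)
    set a := -(1 / 2 : ℝ) • (A ∘ₗ infAction (G := G) 𝓘(ℝ, E) 𝓘(ℝ, EM) x)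
    have hac : a ∈ c.dualAnnihilator := Submodule.smul_mem _ _ hA
    -- The element of `ĉ` with `ξ = 0`: the minus sign in its second entry cancels that in the
    -- generator formula and produces `μ_* v`.
    have hmem : (0 + sharp s a, 0 - sharp s a) ∈ lieAlgebraInProd 𝓘(ℝ, EC') ι' := by
      rw [hC']
      exact ⟨0, c.zero_mem, a, hac, rfl⟩
    obtain ⟨ζ, hζ⟩ := hmem
    have h1 := congrArg Prod.fst hζ
    have h2 := congrArg Prod.snd hζ
    simp only [zero_add, zero_sub] at h1 h2
    have h3 := hK.generator_mem_tangentTo hτ hι' hx ζ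
    rw [h1, h2, map_neg, sub_neg_eq_add] at h3
    rwa [hμ.mfderiv_eq hs hv]

end MomentMap

/-! ### Lifting the reduced space to the clean intersection -/

section Reduction

variable {E : Type*} [NormedAddCommGroup E] [NormedSpace ℝ E]
  {G : Type*} [TopologicalSpace G] [ChartedSpace E G]
  {EM : Type*} [NormedAddCommGroup EM] [NormedSpace ℝ EM]
  {M : Type*} [TopologicalSpace M] [ChartedSpace EM M]
  {EQ : Type*} [NormedAddCommGroup EQ] [NormedSpace ℝ EQ]
  {Q : Type*} [TopologicalSpace Q] [ChartedSpace EQ Q]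
  {μ : M → G} {q : M → Q}

/-- If `μ⁻¹(K)` is saturated with respect to the submersion `q`, then `q` has local sections whose
graphs map `q(μ⁻¹(K))` to the intersection of `graph μ` with `K × M`. -/
theorem exists_local_section_graph
    (hq : Manifold.IsSubmersion 𝓘(ℝ, EM) 𝓘(ℝ, EQ) ∞ q) (hsurj : Function.Surjective q)
    (hμ : ContMDiff 𝓘(ℝ, EM) 𝓘(ℝ, E) ∞ μ) {K : Set G}
    (hsat : ∀ x x', q x = q x' → μ x ∈ K → μ x' ∈ K) (y₀ : Q) :
    ∃ σ : Q → G × M, ∃ V, IsOpen V ∧ y₀ ∈ V ∧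
      ContMDiffOn 𝓘(ℝ, EQ) (𝓘(ℝ, E).prod 𝓘(ℝ, EM)) ∞ σ V ∧
      (∀ y ∈ V, (q ∘ Prod.snd) (σ y) = y) ∧
      MapsTo σ (V ∩ q '' (μ ⁻¹' K)) (graph μ ∩ K ×ˢ (univ : Set M)) := by
  obtain ⟨x₀, rfl⟩ := hsurj y₀
  obtain ⟨σ, V, hV, hxV, hσ, hqσ, -⟩ := exists_local_section (hq.isSubmersionAt x₀)
  refine ⟨fun y => (μ (σ y), σ y), V, hV, hxV, (hμ.comp_contMDiffOn hσ).prodMk hσ, hqσ, ?_⟩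
  rintro y ⟨hy, x, hx, rfl⟩
  exact ⟨⟨σ (q x), rfl⟩, hsat x _ (hqσ _ hy).symm hx, mem_univ _⟩

end Reduction

/-- Exhibits the reduced space as an image of the clean intersection itself, so `μ⁻¹(K)` need not be
treated as a submanifold of `M`. -/
theorem image_graph_inter {G M Q : Type*} (μ : M → G) (q : M → Q) (K : Set G) :
    (q ∘ Prod.snd) '' (graph μ ∩ K ×ˢ (univ : Set M)) = q '' (μ ⁻¹' K) := by
  ext y
  constructor
  · rintro ⟨_, ⟨⟨x, rfl⟩, hx, -⟩, rfl⟩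
    exact ⟨x, hx, rfl⟩
  · rintro ⟨x, hx, rfl⟩
    exact ⟨(μ x, x), ⟨⟨x, rfl⟩, hx, mem_univ _⟩, rfl⟩

section HatStable

variable {G : Type*} [Group G] {L : Type*} [Group L]

theorem isHatStable_hatOrbit (ι : L →* G × G) (τ : G ≃* G) (g₀ : G) :
    IsHatStable ι τ (hatOrbit ι τ g₀) := by
  rintro l _ ⟨l', rfl⟩
  exact ⟨l * l', by simp [twistedAct, mul_assoc]⟩

end HatStable

end QuasiPoisson

end

/-! ### The reduction theorem -/

open QuasiPoisson in
theorem mainTheorem6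
    -- the Lie group `G`
    {E : Type*} [NormedAddCommGroup E] [NormedSpace ℝ E] [FiniteDimensional ℝ E]
    {G : Type*} [TopologicalSpace G] [T2Space G] [SecondCountableTopology G] [ChartedSpace E G]
    [Group G] [LieGroup 𝓘(ℝ, E) ∞ G]
    -- the `G`-manifold `M`
    {EM : Type*} [NormedAddCommGroup EM] [NormedSpace ℝ EM] [FiniteDimensional ℝ EM]
    {M : Type*} [TopologicalSpace M] [T2Space M] [SecondCountableTopology M] [ChartedSpace EM M]
    [IsManifold 𝓘(ℝ, EM) ∞ M] [MulAction G M] [ContMDiffSMul 𝓘(ℝ, E) 𝓘(ℝ, EM) ∞ G M]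
    -- the Lie groups `C` and `Ĉ`
    {EC : Type*} [NormedAddCommGroup EC] [NormedSpace ℝ EC] [FiniteDimensional ℝ EC]
    {C : Type*} [TopologicalSpace C] [T2Space C] [SecondCountableTopology C] [ChartedSpace EC C]
    [Group C] [LieGroup 𝓘(ℝ, EC) ∞ C]
    {EC' : Type*} [NormedAddCommGroup EC'] [NormedSpace ℝ EC'] [FiniteDimensional ℝ EC']
    {C' : Type*} [TopologicalSpace C'] [T2Space C'] [SecondCountableTopology C']
    [ChartedSpace EC' C'] [Group C'] [LieGroup 𝓘(ℝ, EC') ∞ C']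
    -- the manifold `Q = M/C`
    {EQ : Type*} [NormedAddCommGroup EQ] [NormedSpace ℝ EQ] [FiniteDimensional ℝ EQ]
    {Q : Type*} [TopologicalSpace Q] [T2Space Q] [SecondCountableTopology Q] [ChartedSpace EQ Q]
    [IsManifold 𝓘(ℝ, EQ) ∞ Q]
    -- the quasi-Poisson structure and the moment map
    (s : Tensor2 𝓘(ℝ, E) G) (hs : IsInvariantSymmetric s)
    (π : BivectorField 𝓘(ℝ, EM) M) (hπ : IsQuasiPoisson s π)
    (τ : G ≃* G) (hτ : IsPreservingAut s τ)
    (μ : M → G) (hμ : IsMomentMap s τ π μ)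
    -- the reducing subgroup `C ⊆ G`, with Lie algebra the range of the differential of `ι`
    (ι : C →* G) (hι : IsLieSubgroup 𝓘(ℝ, E) 𝓘(ℝ, EC) ι)
    (hC : IsReducing s (LinearMap.range (lieMap 𝓘(ℝ, EC) 𝓘(ℝ, E) ι)))
    (q : M → Q) (hq : IsOrbitSpace ι 𝓘(ℝ, EM) 𝓘(ℝ, EQ) q)
    -- the subgroup `Ĉ ⊆ G × G` with Lie algebra `ĉ`, which contains the diagonal copy of `C`
    (ι' : C' →* G × G)
    (hι' : IsLieSubgroup (𝓘(ℝ, E).prod 𝓘(ℝ, E)) 𝓘(ℝ, EC') ι')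
    (hC' : lieAlgebraInProd 𝓘(ℝ, EC') ι' =
      hatAlgebra s (LinearMap.range (lieMap 𝓘(ℝ, EC) 𝓘(ℝ, E) ι)))
    (hdiag : ∀ c : C, ∃ c' : C', ι' c' = (ι c, ι c)) :
    ∃ πQ : BivectorField 𝓘(ℝ, EQ) Q,
      πQ.IsPoisson ∧ π.DescendsTo q πQ ∧
      (∀ πQ' : BivectorField 𝓘(ℝ, EQ) Q, π.DescendsTo q πQ' → πQ' = πQ) ∧
      ∀ K : Set G,
        ((∃ g₀ : G, K = hatOrbit ι' τ g₀) ∨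
          (IsSubmanifold 𝓘(ℝ, E) K ∧ IsHatStable ι' τ K)) →
        IntersectCleanly (𝓘(ℝ, E).prod 𝓘(ℝ, EM)) (graph μ) (K ×ˢ (Set.univ : Set M)) →
        πQ.IsPoissonSubmanifold (q '' (μ ⁻¹' K)) ∧
        (IsEmbeddedSubmanifold (𝓘(ℝ, E).prod 𝓘(ℝ, EM)) (graph μ ∩ K ×ˢ (Set.univ : Set M)) →
          IsEmbeddedSubmanifold 𝓘(ℝ, EQ) (q '' (μ ⁻¹' K))) := by
  have hqs : ContMDiff 𝓘(ℝ, EM) 𝓘(ℝ, EQ) ∞ q := hq.submersion.contMDiff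
  have hι'' := hι'.smooth
  have hsmul : ∀ g : G, ContMDiff 𝓘(ℝ, EM) 𝓘(ℝ, EM) ∞ fun x : M => g • x := fun g =>
    (contMDiff_smul (I := 𝓘(ℝ, E)) (I' := 𝓘(ℝ, EM)) (n := ∞) (G := G) (M := M)).comp
      (contMDiff_const.prodMk contMDiff_id)
  obtain ⟨πQ, hπQ⟩ := exists_descendsTo hq.submersion hqs hq.surjective
    (hq.pushForwardAt_eq hqs hsmul hπ.invariant)
  refine ⟨πQ, hq.isPoisson hqs hι.smooth hC hπ hπQ, hπQ,
    fun πQ' h => h.unique hπQ hq.surjective, fun K hK hclean => ?_⟩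
  have hstable : IsHatStable ι' τ K := by
    rcases hK with ⟨g₀, rfl⟩ | hK
    · exact isHatStable_hatOrbit ι' τ g₀
    · exact hK.2
  have hsat : ∀ x x', q x = q x' → μ x ∈ K → μ x' ∈ K := by
    intro x x' h hx
    obtain ⟨c, rfl⟩ := (hq.fibers x x').1 h
    obtain ⟨c', hc'⟩ := hdiag c
    have h1 := hstable c' _ hx
    -- The diagonal element `(c, c)` acts on `G` by `g ↦ τ(c) g c⁻¹`, which is the equivariance rule
    -- of `μ`.
    rwa [hc', twistedAct, ← hμ.equivariant] at h1
  have hp : ContMDiff (𝓘(ℝ, E).prod 𝓘(ℝ, EM)) 𝓘(ℝ, EQ) ∞ (q ∘ (Prod.snd : G × M → M)) :=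
    hqs.comp contMDiff_snd
  have himage := image_graph_inter μ q K
  have hsec := fun y₀ (_ : y₀ ∈ q '' (μ ⁻¹' K)) =>
    exists_local_section_graph hq.submersion hq.surjective hμ.smooth hsat y₀
  refine ⟨⟨hclean.1.of_sections hp himage hsec, ?_⟩,
    fun hemb => hemb.of_sections hp himage hsec⟩
  rintro _ ⟨x, hx, rfl⟩ α
  set A : Cotangent 𝓘(ℝ, EM) x := α ∘ₗ (mfderiv 𝓘(ℝ, EM) 𝓘(ℝ, EQ) q x).toLinearMap
  -- By reflexivity, the linear form `π(·, A)` on covectors is evaluation at a vector, the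
  -- Hamiltonian vector of `A`.
  let v : TangentSpace 𝓘(ℝ, EM) x :=
    (Module.evalEquiv ℝ (TangentSpace 𝓘(ℝ, EM) x)).symm ((π.toFun x).flip A)
  have hv : ∀ β : Cotangent 𝓘(ℝ, EM) x, β v = π.toFun x β A := fun β => by simp [v]
  have h1 := hμ.mem_tangentTo hs hτ.smooth hι'' hC' hstable hclean hx
    (hq.pullback_mem_dualAnnihilator hqs hι.smooth x α) hv
  have h2 := mem_tangentTo_map (B := q '' (μ ⁻¹' K)) h1 hp
    (himage ▸ Set.mapsTo_image _ _)
  refine ⟨mfderiv 𝓘(ℝ, EM) 𝓘(ℝ, EQ) q x v, mem_tangentTo_of_eq rfl ?_ h2, fun β => ?_⟩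
  · refine (mfderiv_comp_apply (μ x, x) (hqs.mdifferentiable (by simp) _)
      mdifferentiableAt_snd _).trans ?_
    rw [mfderiv_snd]
    rfl
  · exact (hv (β ∘ₗ (mfderiv 𝓘(ℝ, EM) 𝓘(ℝ, EQ) q x).toLinearMap)).trans (hπQ x β α).symm
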